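/- **Setting.** An $N$-qubit state is a density matrix on $(\mathbb C^2)^{\otimes N}$. The fidelity is $F(\rho,\sigma)=\big(\operatorname{tr}\sqrt{\sqrt\rho\,\sigma\sqrt\rho}\big)^2$. A distance $D$ is a metric on the $N$-qubit states, for every $N$. It is *strictly related to the fidelity* through $\eta$ if $\eta(0)=0$ and, on the set $I_D$ of all $\varepsilon\ge 0$ less than the maximum value that $D$ assumes, $\eta$ is strictly increasing with values in $[0,1]$, and $D(\rho,\sigma)\le\varepsilon$ implies $F(\rho,\sigma)\ge 1-\eta(\varepsilon)$. The geometric measure of a pure state is $E_G(\psi)=1-\max|\langle\psi|\phi_1\otimes\cdots\otimes\phi_N\rangle|^2$ over unit vectors $\phi_i\in\mathbb C^2$. It is extended to mixed states by the convex roof, $E_G(\rho)=\inf\sum_ip_iE_G(\psi_i)$ over all $\rho=\sum_ip_i|\psi_i\rangle\langle\psi_i|$. Put $(E_G)_\varepsilon(\rho)=\inf\{E_G(\sigma): D(\sigma,\rho)\le\varepsilon\}$, let $(E_G)_\varepsilon^*$ be its supremum over all states of any number of qubits, and for a family $\Sigma$ of states put $E_G(\Sigma)=\sup_{\sigma\in\Sigma}E_G(\sigma)$.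 A family $\Sigma$ is an *$\varepsilon$-approximate universal resource* (with respect to $D$) if for every $N\ge1$ and every $N$-qubit pure state $\phi$ there are $M\ge N$, an $M$-qubit state $\sigma\in\Sigma$ and a (finite-round) LOCC protocol between the $M$ parties, each holding one qubit and local ancillas, with output branches $\{p_i,\rho_i\}$, such that the probabilities $p_i$ of the branches with $D\big(\rho_i,|\phi\rangle\langle\phi|\otimes|0\rangle\langle0|^{\otimes(M-N)}\big)\le\varepsilon$ sum to $1$. Let $\Psi_W=\{|W_N\rangle\}_{N\ge1}$, where $|W_N\rangle=N^{-1/2}\sum_{i=1}^N|e_{N,i}\rangle$ and $|e_{N,i}\rangle$ is the computational basis state with $1$ in position $i$ and $0$ elsewhere. **Statement.** $E_G(\Psi_W)=1-\frac1{\mathrm e}$. Moreover, let $D$ be a distance that is strictly related to the fidelity through $\eta$. Then: 1. For every $\varepsilon\in I_D$ with $\eta=\eta(\varepsilon)\le 0.1\%$, $$E_G(\Psi_W)<1-4\eta^{1/3}+3.4\,\eta^{2/3}\le (E_G)_\varepsilon^*.$$ 2. If $\bar\varepsilon\in I_D$ and $\eta(\bar\varepsilon)\le 0.1\%$ (in particular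 if $\eta(\bar\varepsilon)=0.1\%$), then $\Psi_W$ is not an $\varepsilon$-approximate universal resource with respect to $D$ for any $\varepsilon\le\bar\varepsilon$. 3. If $\eta$ is right-continuous at $0$, then such an $\bar\varepsilon>0$ exists. -/

import Mathlib

namespace MQC

noncomputable section

open scoped Matrix MatrixOrder ComplexOrder

/-! ### States of qubits and the fidelity -/

/-- Labels of the computational basis of `N` qubits. -/
abbrev Bits (N : ℕ) : Type := Fin N → Fin 2

/-- A pure state of `N` qubits: a unit vector of `(ℂ²)^{⊗N}`. -/
structure PureState (N : ℕ) where
  vec : EuclideanSpace ℂ (Bits N)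
  norm_vec : ‖vec‖ = 1

/-- A (mixed) state of `N` qubits: a density matrix. -/
@[ext]
structure State (N : ℕ) where
  mat : Matrix (Bits N) (Bits N) ℂ
  posSemidef : mat.PosSemidef
  trace_eq_one : mat.trace = 1

/-- The projector `|ψ⟩⟨ψ|`. -/
def PureState.proj {N : ℕ} (ψ : PureState N) : Matrix (Bits N) (Bits N) ℂ :=
  Matrix.vecMulVec ψ.vec.ofLp (star ψ.vec.ofLp)

/-- A pure state regarded as a density matrix. -/
def PureState.toState {N : ℕ} (ψ : PureState N) : State N where
  mat := ψ.proj
  posSemidef := Matrix.posSemidef_vecMulVec_self_star _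
  trace_eq_one := by
    rw [PureState.proj, Matrix.trace_vecMulVec, ← EuclideanSpace.inner_eq_star_dotProduct,
      inner_self_eq_norm_sq_to_K, ψ.norm_vec]
    simp

/-- The (Uhlmann) fidelity `F(ρ, σ) = (tr √(√ρ σ √ρ))²`; on pure states it is `|⟨ψ|φ⟩|²`. -/
def fidelity {N : ℕ} (ρ σ : State N) : ℝ :=
  ((CFC.sqrt (CFC.sqrt ρ.mat * σ.mat * CFC.sqrt ρ.mat)).trace.re) ^ 2

/-! ### Distances strictly related to the fidelity -/

/-- A distance on the set of states: a metric on the `N`-qubit states, for every `N`. -/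
abbrev StateDistance : Type := ∀ N : ℕ, MetricSpace (State N)

/-- The distance `D(ρ, σ)`. -/
def StateDistance.val (D : StateDistance) {N : ℕ} (ρ σ : State N) : ℝ := (D N).dist ρ σ

/-- The reals `ε ≥ 0` that are less than the maximum value (possibly infinite) that `D` assumes. -/
def StateDistance.domain (D : StateDistance) : Set ℝ :=
  {ε | 0 ≤ ε ∧ ∃ (N : ℕ) (ρ σ : State N), ε < D.val ρ σ}

/-- `D` is strictly related to the fidelity, through the function `η`. -/
structure StrictlyRelated (D : StateDistance) (η : ℝ → ℝ) : Prop where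
  zero : η 0 = 0
  mem_Icc : ∀ ε ∈ D.domain, η ε ∈ Set.Icc (0 : ℝ) 1
  strictMonoOn : StrictMonoOn η D.domain
  fidelity_ge : ∀ ε ∈ D.domain, ∀ (N : ℕ) (ρ σ : State N),
    D.val ρ σ ≤ ε → 1 - η ε ≤ fidelity ρ σ

/-! ### Geometric measure, `ε`-measures, asymptotic entanglement -/

/-- The factorized vector `|φ₁⟩ ⊗ ⋯ ⊗ |φ_N⟩`. -/
def productVec {N : ℕ} (φ : Fin N → EuclideanSpace ℂ (Fin 2)) : EuclideanSpace ℂ (Bits N) :=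
  WithLp.toLp 2 fun x => ∏ i, φ i (x i)

/-- `π(ψ)`: the maximal fidelity between `ψ` and a factorized state. -/
def maxProductFidelity {N : ℕ} (ψ : PureState N) : ℝ :=
  sSup {r : ℝ | ∃ φ : Fin N → EuclideanSpace ℂ (Fin 2),
    (∀ i, ‖φ i‖ = 1) ∧ r = ‖inner ℂ ψ.vec (productVec φ)‖ ^ 2}

/-- The geometric measure of a pure state. -/
def pureGeometricMeasure {N : ℕ} (ψ : PureState N) : ℝ := 1 - maxProductFidelity ψ

/-- The geometric measure of a state: the convex roof of `pureGeometricMeasure`. -/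
def geometricMeasure (N : ℕ) (ρ : State N) : ℝ :=
  sInf {r : ℝ | ∃ (n : ℕ) (p : Fin n → ℝ) (ψ : Fin n → PureState N),
    (∀ i, 0 ≤ p i) ∧ ∑ i, p i = 1 ∧ ρ.mat = ∑ i, (p i : ℂ) • (ψ i).proj ∧
    r = ∑ i, p i * pureGeometricMeasure (ψ i)}

/-- The `ε`-version of an entanglement measure `E`, relative to the distance `D`. -/
def epsMeasure (D : StateDistance) (E : ∀ N : ℕ, State N → ℝ) (ε : ℝ) (N : ℕ) (ρ : State N) : ℝ :=
  sInf {r : ℝ | ∃ σ : State N, D.val σ ρ ≤ ε ∧ r = E N σ}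

/-- A family of many-qubit states, of possibly different sizes. -/
abbrev Family : Type := Set (Σ N : ℕ, State N)

/-- The asymptotic entanglement `E(Σ) = sup_{σ ∈ Σ} E(σ)` of a family. -/
def familyEntanglement (E : ∀ N : ℕ, State N → ℝ) (S : Family) : EReal :=
  ⨆ s ∈ S, ((E s.1 s.2 : ℝ) : EReal)

/-- The asymptotic entanglement `E^*`: the supremum over all states of all sizes. -/
def asymptoticEntanglement (E : ∀ N : ℕ, State N → ℝ) : EReal :=
  ⨆ s : (Σ N : ℕ, State N), ((E s.1 s.2 : ℝ) : EReal)

/-! ### LOCC protocols -/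

/-- The operator acting as `A` on party `k` and as the identity on all other parties. -/
def localOp {M : ℕ} {X : Type} [DecidableEq X] (k : Fin M) (A : Matrix X X ℂ) :
    Matrix (Fin M → X) (Fin M → X) ℂ :=
  Matrix.of fun y x => if ∀ i, i ≠ k → y i = x i then A (y k) (x k) else 0

/-- The decision tree of a finite-round LOCC protocol between `M` parties, each of which holds a
system with basis `X`. In a round, some party `k` performs a generalized measurement with Kraus
operators `K j`; the outcome `j` is announced to all parties and everything that follows may depend
on it. At the end the parties declare one of `r` final outcomes; since different measurement
records may lead to the same final outcome, classical information may be discarded. -/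
inductive LOCCTree (M : ℕ) (X : Type) [Fintype X] [DecidableEq X] (r : ℕ) : Type
  | done (i : Fin r) : LOCCTree M X r
  | measure (k : Fin M) (n : ℕ) (K : Fin n → Matrix X X ℂ) (hK : ∑ j, (K j)ᴴ * K j = 1)
      (next : Fin n → LOCCTree M X r) : LOCCTree M X r

/-- The unnormalized state that belongs to the final outcome `i`, when the tree is run on the
(unnormalized) state `τ`. -/
def LOCCTree.run {M : ℕ} {X : Type} [Fintype X] [DecidableEq X] {r : ℕ} :
    LOCCTree M X r → Matrix (Fin M → X) (Fin M → X) ℂ → Fin r → Matrix (Fin M → X) (Fin M → X) ℂ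
  | .done i₀, τ, i => if i = i₀ then τ else 0
  | .measure k _ K _ next, τ, i =>
      ∑ j, (next j).run (localOp k (K j) * τ * (localOp k (K j))ᴴ) i

/-- Every party adds to its qubit a local ancilla of dimension `a + 1` in the state `|0⟩`. -/
def addAncillas {M : ℕ} (a : ℕ) (τ : Matrix (Bits M) (Bits M) ℂ) :
    Matrix (Fin M → Fin 2 × Fin (a + 1)) (Fin M → Fin 2 × Fin (a + 1)) ℂ :=
  Matrix.of fun x y =>
    if (∀ i, (x i).2 = 0) ∧ (∀ i, (y i).2 = 0) then
      τ (fun i => (x i).1) (fun i => (y i).1)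
    else 0

/-- Every party discards its local ancilla (partial trace). -/
def traceAncillas {M : ℕ} (a : ℕ)
    (τ : Matrix (Fin M → Fin 2 × Fin (a + 1)) (Fin M → Fin 2 × Fin (a + 1)) ℂ) :
    Matrix (Bits M) (Bits M) ℂ :=
  Matrix.of fun x y => ∑ s : Fin M → Fin (a + 1), τ (fun i => (x i, s i)) (fun i => (y i, s i))

/-- An LOCC protocol on `M` qubits, each held by a separate party, with local ancillas of
arbitrary finite dimension. -/
structure LOCCProtocol (M : ℕ) where
  ancilla : ℕ
  outcomes : ℕ
  tree : LOCCTree M (Fin 2 × Fin (ancilla + 1)) outcomes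

/-- The unnormalized output `p_i ρ_i` of the branch `i`. -/
def LOCCProtocol.output {M : ℕ} (Λ : LOCCProtocol M) (σ : State M) (i : Fin Λ.outcomes) :
    Matrix (Bits M) (Bits M) ℂ :=
  traceAncillas Λ.ancilla (Λ.tree.run (addAncillas Λ.ancilla σ.mat) i)

/-- The probability `p_i` of the branch `i`. -/
def LOCCProtocol.prob {M : ℕ} (Λ : LOCCProtocol M) (σ : State M) (i : Fin Λ.outcomes) : ℝ :=
  (Λ.output σ i).trace.re

/-- `ρ` is the output state `ρ_i` of the branch `i` (no constraint on `ρ` if `p_i = 0`). -/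
def LOCCProtocol.IsBranchState {M : ℕ} (Λ : LOCCProtocol M) (σ : State M) (i : Fin Λ.outcomes)
    (ρ : State M) : Prop :=
  Λ.output σ i = (Λ.prob σ i : ℂ) • ρ.mat

open Classical in
/-- The total probability of the branches whose output is within distance `ε` of `τ`. -/
def LOCCProtocol.successProb {M : ℕ} (Λ : LOCCProtocol M) (D : StateDistance) (ε : ℝ)
    (σ τ : State M) : ℝ :=
  ∑ i, if ∃ ρ, Λ.IsBranchState σ i ρ ∧ D.val ρ τ ≤ ε then Λ.prob σ i else 0

/-! ### Universality -/

/-- The vector `|φ⟩ ⊗ |0⟩^{⊗k}`. -/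
def padVec {N : ℕ} (φ : EuclideanSpace ℂ (Bits N)) (k : ℕ) : EuclideanSpace ℂ (Bits (N + k)) :=
  WithLp.toLp 2 fun x =>
    φ (fun i => x (Fin.castAdd k i)) * if ∀ j : Fin k, x (Fin.natAdd N j) = 0 then 1 else 0

theorem norm_padVec {N : ℕ} (φ : EuclideanSpace ℂ (Bits N)) (k : ℕ) : ‖padVec φ k‖ = ‖φ‖ := by
  rw [EuclideanSpace.norm_eq, EuclideanSpace.norm_eq]
  congr 1
  rw [← (Fin.appendEquiv N k).sum_comp, Fintype.sum_prod_type]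
  refine Finset.sum_congr rfl fun x _ => ?_
  rw [Finset.sum_eq_single (fun _ => 0)]
  · simp [padVec, Fin.appendEquiv]
  · intro y _ hy
    have : ¬ ∀ j : Fin k, y j = 0 := fun h => hy (funext h)
    simp [padVec, Fin.appendEquiv, this]
  · simp

/-- The state `|φ⟩ ⊗ |0⟩^{⊗k}`. -/
def PureState.pad {N : ℕ} (φ : PureState N) (k : ℕ) : PureState (N + k) where
  vec := padVec φ.vec k
  norm_vec := by rw [norm_padVec, φ.norm_vec]

/-- `S` is an `ε`-approximate (with respect to `D`) `δ`-stochastic universal resource. -/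
def IsApproxStochasticUniversal (D : StateDistance) (ε δ : ℝ) (S : Family) : Prop :=
  ∀ N : ℕ, 0 < N → ∀ φ : PureState N, ∃ (k : ℕ) (σ : State (N + k)), (⟨N + k, σ⟩ ∈ S) ∧
    ∃ Λ : LOCCProtocol (N + k), 1 - δ ≤ Λ.successProb D ε σ (φ.pad k).toState

/-- `S` is an `ε`-approximate (deterministic) universal resource. -/
def IsApproxUniversal (D : StateDistance) (ε : ℝ) (S : Family) : Prop :=
  IsApproxStochasticUniversal D ε 0 S

/-! ### W states -/

/-- `|e_{N,i}⟩`: the basis vector with `1` in position `i` and `0` elsewhere. -/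
def excitation {N : ℕ} (i : Fin N) : EuclideanSpace ℂ (Bits N) :=
  EuclideanSpace.single (Pi.single i 1) 1

/-- The vector `|W_N⟩ = N^{-1/2} ∑ᵢ |e_{N,i}⟩`. -/
def wVec (N : ℕ) : EuclideanSpace ℂ (Bits N) :=
  ((1 / Real.sqrt N : ℝ) : ℂ) • ∑ i : Fin N, excitation i

theorem norm_wVec {N : ℕ} (hN : 0 < N) : ‖wVec N‖ = 1 := by
  have hinj : Function.Injective fun i : Fin N => (Pi.single i 1 : Bits N) := by
    intro i j h
    by_contra hij
    have := congrFun h i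
    simp [hij] at this
  have ho : Orthonormal ℂ fun i : Fin N => excitation i :=
    (EuclideanSpace.orthonormal_single (𝕜 := ℂ) (ι := Bits N)).comp _ hinj
  have hsum : ‖∑ i : Fin N, excitation i‖ ^ 2 = N := by
    have h := ho.inner_sum (fun _ => (1 : ℂ)) (fun _ => 1) Finset.univ
    have h2 := inner_self_eq_norm_sq_to_K (𝕜 := ℂ) (∑ i : Fin N, excitation i)
    simp only [one_smul] at h
    rw [h] at h2
    simp at h2
    exact_mod_cast h2.symm
  have hs : ‖∑ i : Fin N, excitation i‖ = Real.sqrt N := by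
    rw [← hsum, Real.sqrt_sq (norm_nonneg _)]
  have hpos : 0 < Real.sqrt N := Real.sqrt_pos.mpr (by exact_mod_cast hN)
  rw [wVec, norm_smul, hs, Complex.norm_real, Real.norm_of_nonneg (by positivity)]
  field_simp

/-- The `N`-qubit W state, `N ≥ 1`. -/
def wState (N : ℕ) (hN : 0 < N) : PureState N where
  vec := wVec N
  norm_vec := norm_wVec hN

/-- The family of all W states. -/
def wFamily : Family := {s | ∃ (N : ℕ) (hN : 0 < N), s = ⟨N, (wState N hN).toState⟩}

end

end MQC

/-! Three estimates carry the theorem.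

The value for W states: by the triangle inequality phases can be dropped, so the overlap with a
product vector becomes `excitationSum` of angles in [0, π/2], up to the factor 1/√N. At a maximum
either all angles agree, and a one-variable exponential estimate gives (1 + 1/n)/e for N = n + 1, or
the sum is at most 1. Choosing excitation probability 1/N at every site gives at least 1/e for each
N. The supremum 1 - 1/e is thus approached in the limit of large N.

The lower bound on the ε-measure: m Bell pairs have fidelity at most 2^(-m) with any product state.
A pure state with large overlap with them cannot be close to a product state, and the resulting
bound on its geometric measure is affine in the squared overlap, hence survives the convex roof
(`geometricMeasure_ge_fidelity`). All states ε-close to the Bell pairs have fidelity at least 1 - η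
with them, and letting m grow gives 1 - η. The polynomial in η^(1/3) lies between 1 - 1/e and 1 - η
by elementary estimates.

Non-universality is proved without monotonicity of the geometric measure under LOCC. The W state is
split into its projection onto a product vector with squared overlap at least 1/e and an orthogonal
remainder. Kraus operators act linearly, and local ones keep product vectors product, so the first
component contributes almost nothing to the fidelity with ten Bell pairs; the remainder contributes
at most its squared norm (`LOCCProtocol.sum_expectation_output_le`). Even with the cross terms the
mean fidelity stays below 0.96, whereas universality would force at least 0.999. -/

namespace MQC

open scoped Matrix MatrixOrder ComplexOrder

/-! ### Fidelity with a pure state -/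

/-- The expectation value `⟨ψ|A|ψ⟩`. -/
def expectation {N : ℕ} (ψ : PureState N) (A : Matrix (Bits N) (Bits N) ℂ) : ℝ :=
  (star ψ.vec.ofLp ⬝ᵥ A *ᵥ ψ.vec.ofLp).re

theorem PureState.star_dotProduct_self {N : ℕ} (ψ : PureState N) :
    star ψ.vec.ofLp ⬝ᵥ ψ.vec.ofLp = 1 := by
  rw [dotProduct_comm, ← EuclideanSpace.inner_eq_star_dotProduct, inner_self_eq_norm_sq_to_K,
    ψ.norm_vec]
  simp

theorem PureState.proj_mul_mul_proj {N : ℕ} (ψ : PureState N) (A : Matrix (Bits N) (Bits N) ℂ) :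
    ψ.proj * A * ψ.proj = (star ψ.vec.ofLp ⬝ᵥ A *ᵥ ψ.vec.ofLp) • ψ.proj := by
  rw [PureState.proj, Matrix.mul_assoc, Matrix.mul_vecMulVec, Matrix.vecMulVec_mul_vecMulVec,
    Matrix.vecMulVec_smul]

theorem PureState.proj_mul_proj {N : ℕ} (ψ : PureState N) : ψ.proj * ψ.proj = ψ.proj := by
  rw [PureState.proj, Matrix.vecMulVec_mul_vecMulVec, ψ.star_dotProduct_self, one_smul]

theorem PureState.proj_nonneg {N : ℕ} (ψ : PureState N) : 0 ≤ ψ.proj :=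
  Matrix.nonneg_iff_posSemidef.mpr ψ.toState.posSemidef

theorem PureState.sqrt_proj {N : ℕ} (ψ : PureState N) : CFC.sqrt ψ.proj = ψ.proj :=
  CFC.sqrt_unique ψ.proj_mul_proj ψ.proj_nonneg

theorem expectation_nonneg {N : ℕ} (ψ : PureState N) {A : Matrix (Bits N) (Bits N) ℂ}
    (hA : A.PosSemidef) : 0 ≤ expectation ψ A :=
  (Complex.nonneg_iff.mp (hA.dotProduct_mulVec_nonneg ψ.vec.ofLp)).1

/-- A projector is its own square root, so the sandwiched operator is the expectation value times
the projector; its square root has as trace the root of that value. -/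
theorem fidelity_toState_left {N : ℕ} (ψ : PureState N) (σ : State N) :
    fidelity ψ.toState σ = expectation ψ σ.mat := by
  have h0 := expectation_nonneg ψ σ.posSemidef
  have hc : star ψ.vec.ofLp ⬝ᵥ σ.mat *ᵥ ψ.vec.ofLp = (expectation ψ σ.mat : ℂ) := by
    have h := Complex.nonneg_iff.mp (σ.posSemidef.dotProduct_mulVec_nonneg ψ.vec.ofLp)
    apply Complex.ext
    · rfl
    · simpa using h.2.symm
  have hs : CFC.sqrt ((expectation ψ σ.mat : ℂ) • ψ.proj)
      = ((Real.sqrt (expectation ψ σ.mat) : ℝ) : ℂ) • ψ.proj := by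
    apply CFC.sqrt_unique
    · rw [smul_mul_smul_comm, ψ.proj_mul_proj, ← Complex.ofReal_mul, Real.mul_self_sqrt h0]
    · exact smul_nonneg (Complex.zero_le_real.mpr (Real.sqrt_nonneg _)) ψ.proj_nonneg
  have ht : ψ.proj.trace = 1 := ψ.toState.trace_eq_one
  rw [fidelity]
  change ((CFC.sqrt (CFC.sqrt ψ.proj * σ.mat * CFC.sqrt ψ.proj)).trace.re) ^ 2 = _
  rw [ψ.sqrt_proj, ψ.proj_mul_mul_proj, hc, hs, Matrix.trace_smul, ht]
  simp [Real.sq_sqrt h0]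

theorem star_dotProduct_vecMulVec_mulVec {ι : Type*} [Fintype ι] (x v : EuclideanSpace ℂ ι) :
    star x.ofLp ⬝ᵥ Matrix.vecMulVec v.ofLp (star v.ofLp) *ᵥ x.ofLp
      = ((‖inner ℂ x v‖ ^ 2 : ℝ) : ℂ) := by
  rw [Matrix.vecMulVec_mulVec, dotProduct_smul]
  have h1 : star x.ofLp ⬝ᵥ v.ofLp = inner ℂ x v := by
    rw [EuclideanSpace.inner_eq_star_dotProduct, dotProduct_comm]
  have h2 : star v.ofLp ⬝ᵥ x.ofLp = inner ℂ v x := by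
    rw [EuclideanSpace.inner_eq_star_dotProduct, dotProduct_comm]
  rw [h1, h2, MulOpposite.smul_eq_mul_unop, MulOpposite.unop_op, ← inner_conj_symm v x,
    RCLike.mul_conj]
  push_cast
  rfl

theorem expectation_proj {N : ℕ} (ψ χ : PureState N) :
    expectation ψ χ.proj = ‖inner ℂ ψ.vec χ.vec‖ ^ 2 := by
  rw [expectation, PureState.proj, star_dotProduct_vecMulVec_mulVec, Complex.ofReal_re]

theorem expectation_sum_smul_proj {N : ℕ} (T : PureState N) {n : ℕ} (p : Fin n → ℝ)
    (ψ : Fin n → PureState N) :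
    expectation T (∑ i, (p i : ℂ) • (ψ i).proj) = ∑ i, p i * ‖inner ℂ T.vec (ψ i).vec‖ ^ 2 := by
  simp_rw [← expectation_proj, expectation, Matrix.sum_mulVec, dotProduct_sum, Complex.re_sum,
    Matrix.smul_mulVec, dotProduct_smul, smul_eq_mul, Complex.re_ofReal_mul]

/-! ### Ensembles of pure states -/

/-- The spectral decomposition. It makes the set in the convex roof nonempty, so that its infimum is
not the default value 0. -/
theorem State.exists_ensemble {N : ℕ} (ρ : State N) :
    ∃ (n : ℕ) (p : Fin n → ℝ) (ψ : Fin n → PureState N),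
      (∀ i, 0 ≤ p i) ∧ ∑ i, p i = 1 ∧ ρ.mat = ∑ i, (p i : ℂ) • (ψ i).proj := by
  have hH := ρ.posSemidef.isHermitian
  let e := Fintype.equivFin (Bits N)
  let ψ : Bits N → PureState N := fun i =>
    ⟨hH.eigenvectorBasis i, hH.eigenvectorBasis.orthonormal.norm_eq_one i⟩
  refine ⟨Fintype.card (Bits N), fun i => hH.eigenvalues (e.symm i), fun i => ψ (e.symm i),
    fun i => ρ.posSemidef.eigenvalues_nonneg _, ?_, ?_⟩
  · rw [e.symm.sum_comp (fun i => hH.eigenvalues i)]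
    have h := hH.trace_eq_sum_eigenvalues
    rw [ρ.trace_eq_one] at h
    simpa using congrArg Complex.re h.symm
  · rw [e.symm.sum_comp (fun i => (hH.eigenvalues i : ℂ) • (ψ i).proj)]
    conv_lhs => rw [hH.spectral_theorem]
    ext x y
    rw [Unitary.conjStarAlgAut_apply, Matrix.mul_apply, Matrix.sum_apply]
    refine Finset.sum_congr rfl fun i _ => ?_
    rw [Matrix.mul_diagonal, Matrix.smul_apply, PureState.proj, Matrix.vecMulVec_apply]
    simp [ψ, Matrix.star_apply, Matrix.IsHermitian.eigenvectorUnitary_apply]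
    ring

/-! ### The geometric measure -/

theorem norm_productVec {N : ℕ} (φ : Fin N → EuclideanSpace ℂ (Fin 2)) :
    ‖productVec φ‖ = ∏ i, ‖φ i‖ := by
  simp_rw [EuclideanSpace.norm_eq]
  rw [← Real.sqrt_prod _ fun i _ => by positivity, Finset.prod_univ_sum, Fintype.piFinset_univ]
  simp [productVec, Finset.prod_pow]

theorem norm_inner_productVec_le_one {N : ℕ} (ψ : PureState N)
    {φ : Fin N → EuclideanSpace ℂ (Fin 2)} (hφ : ∀ i, ‖φ i‖ = 1) :
    ‖inner ℂ ψ.vec (productVec φ)‖ ^ 2 ≤ 1 := by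
  have h := norm_inner_le_norm (𝕜 := ℂ) ψ.vec (productVec φ)
  rw [ψ.norm_vec, norm_productVec] at h
  simp only [hφ, Finset.prod_const_one, mul_one] at h
  exact pow_le_one₀ (norm_nonneg _) h

theorem maxProductFidelity_le {N : ℕ} {ψ : PureState N} {δ : ℝ}
    (h : ∀ φ : Fin N → EuclideanSpace ℂ (Fin 2), (∀ i, ‖φ i‖ = 1) →
      ‖inner ℂ ψ.vec (productVec φ)‖ ^ 2 ≤ δ) : maxProductFidelity ψ ≤ δ := by
  apply csSup_le
  · exact ⟨_, fun _ => EuclideanSpace.single 0 1, by simp, rfl⟩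
  · rintro r ⟨φ, hφ, rfl⟩
    exact h φ hφ

theorem le_maxProductFidelity {N : ℕ} (ψ : PureState N)
    {φ : Fin N → EuclideanSpace ℂ (Fin 2)} (hφ : ∀ i, ‖φ i‖ = 1) :
    ‖inner ℂ ψ.vec (productVec φ)‖ ^ 2 ≤ maxProductFidelity ψ :=
  le_csSup ⟨1, by rintro r ⟨φ, hφ, rfl⟩; exact norm_inner_productVec_le_one ψ hφ⟩ ⟨φ, hφ, rfl⟩

theorem pureGeometricMeasure_nonneg {N : ℕ} (ψ : PureState N) : 0 ≤ pureGeometricMeasure ψ :=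
  sub_nonneg.mpr (maxProductFidelity_le fun _ hφ => norm_inner_productVec_le_one ψ hφ)

theorem le_geometricMeasure {N : ℕ} {ρ : State N} {c : ℝ}
    (h : ∀ (n : ℕ) (p : Fin n → ℝ) (ψ : Fin n → PureState N), (∀ i, 0 ≤ p i) → ∑ i, p i = 1 →
      ρ.mat = ∑ i, (p i : ℂ) • (ψ i).proj → c ≤ ∑ i, p i * pureGeometricMeasure (ψ i)) :
    c ≤ geometricMeasure N ρ := by
  apply le_csInf
  · obtain ⟨n, p, ψ, h1, h2, h3⟩ := ρ.exists_ensemble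
    exact ⟨_, n, p, ψ, h1, h2, h3, rfl⟩
  · rintro r ⟨n, p, ψ, h1, h2, h3, rfl⟩
    exact h n p ψ h1 h2 h3

theorem bddBelow_geometricMeasure {N : ℕ} (ρ : State N) :
    BddBelow {r : ℝ | ∃ (n : ℕ) (p : Fin n → ℝ) (ψ : Fin n → PureState N),
      (∀ i, 0 ≤ p i) ∧ ∑ i, p i = 1 ∧ ρ.mat = ∑ i, (p i : ℂ) • (ψ i).proj ∧
      r = ∑ i, p i * pureGeometricMeasure (ψ i)} := by
  refine ⟨0, ?_⟩
  rintro r ⟨n, p, ψ, h1, -, -, rfl⟩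
  exact Finset.sum_nonneg fun i _ => mul_nonneg (h1 i) (pureGeometricMeasure_nonneg _)

theorem geometricMeasure_toState_le {N : ℕ} (ψ : PureState N) :
    geometricMeasure N ψ.toState ≤ pureGeometricMeasure ψ := by
  apply csInf_le (bddBelow_geometricMeasure _)
  exact ⟨1, fun _ => 1, fun _ => ψ, by simp, by simp, by simp [PureState.toState], by simp⟩

/-- For unit vectors `t`, `ψ`, `φ`: `|⟨ψ|φ⟩| ≤ |⟨t|ψ⟩| |⟨t|φ⟩| + √(1 - |⟨t|ψ⟩|²)`. -/
theorem norm_inner_le_of_norm_eq_one {E : Type*} [NormedAddCommGroup E] [InnerProductSpace ℂ E]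
    {t ψ φ : E} (ht : ‖t‖ = 1) (hψ : ‖ψ‖ = 1) (hφ : ‖φ‖ = 1) :
    ‖inner ℂ ψ φ‖ ≤ ‖inner ℂ t ψ‖ * ‖inner ℂ t φ‖ + √(1 - ‖inner ℂ t ψ‖ ^ 2) := by
  have hdecomp : inner ℂ ψ φ
      = inner ℂ ψ t * inner ℂ t φ + inner ℂ (ψ - inner ℂ t ψ • t) φ := by
    rw [inner_sub_left, inner_smul_left, inner_conj_symm]
    ring
  have hnorm : ‖ψ - inner ℂ t ψ • t‖ ^ 2 = 1 - ‖inner ℂ t ψ‖ ^ 2 := by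
    rw [norm_sub_sq (𝕜 := ℂ), hψ, norm_smul, ht, inner_smul_right, ← inner_conj_symm ψ t,
      RCLike.mul_conj]
    norm_cast
    ring
  calc ‖inner ℂ ψ φ‖ ≤ ‖inner ℂ ψ t * inner ℂ t φ‖ + ‖inner ℂ (ψ - inner ℂ t ψ • t) φ‖ := by
        rw [hdecomp]; exact norm_add_le _ _
    _ ≤ ‖inner ℂ t ψ‖ * ‖inner ℂ t φ‖ + ‖ψ - inner ℂ t ψ • t‖ * ‖φ‖ := by
        rw [norm_mul, norm_inner_symm ψ t]
        gcongr
        exact norm_inner_le_norm _ _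
    _ = _ := by rw [hφ, mul_one, ← hnorm, Real.sqrt_sq (norm_nonneg _)]

theorem norm_inner_vec_le_one {N : ℕ} (T ψ : PureState N) : ‖inner ℂ T.vec ψ.vec‖ ≤ 1 := by
  simpa [T.norm_vec, ψ.norm_vec] using norm_inner_le_norm (𝕜 := ℂ) T.vec ψ.vec

theorem pureGeometricMeasure_ge {N : ℕ} {T : PureState N} {δ : ℝ}
    (h : ∀ φ : Fin N → EuclideanSpace ℂ (Fin 2), (∀ i, ‖φ i‖ = 1) →
      ‖inner ℂ T.vec (productVec φ)‖ ^ 2 ≤ δ) (ψ : PureState N) :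
    1 - (‖inner ℂ T.vec ψ.vec‖ * √δ + √(1 - ‖inner ℂ T.vec ψ.vec‖ ^ 2)) ^ 2
      ≤ pureGeometricMeasure ψ := by
  rw [pureGeometricMeasure]
  gcongr
  apply maxProductFidelity_le
  intro φ hφ
  gcongr
  refine (norm_inner_le_of_norm_eq_one T.norm_vec ψ.norm_vec
    (by rw [norm_productVec]; simp [hφ])).trans ?_
  gcongr
  exact Real.le_sqrt_of_sq_le (h φ hφ)

/-- With x the overlap of `T` and an ensemble member, expanding the square in
`pureGeometricMeasure_ge` gives at least x² - (2√δ + δ). This is affine in x², and the average of x²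
over the ensemble is the fidelity, whatever the ensemble. -/
theorem geometricMeasure_ge_fidelity {N : ℕ} {T : PureState N} {δ : ℝ} (hδ : 0 ≤ δ)
    (h : ∀ φ : Fin N → EuclideanSpace ℂ (Fin 2), (∀ i, ‖φ i‖ = 1) →
      ‖inner ℂ T.vec (productVec φ)‖ ^ 2 ≤ δ) (σ : State N) :
    fidelity T.toState σ - (2 * √δ + δ) ≤ geometricMeasure N σ := by
  refine le_geometricMeasure fun n p ψ hp hp1 hσ => ?_
  rw [fidelity_toState_left, hσ, expectation_sum_smul_proj]
  have : ∑ i, p i * ‖inner ℂ T.vec (ψ i).vec‖ ^ 2 - (2 * √δ + δ)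
      = ∑ i, p i * (‖inner ℂ T.vec (ψ i).vec‖ ^ 2 - (2 * √δ + δ)) := by
    simp_rw [mul_sub, Finset.sum_sub_distrib, ← Finset.sum_mul, hp1, one_mul]
  rw [this]
  refine Finset.sum_le_sum fun i _ => mul_le_mul_of_nonneg_left ?_ (hp i)
  refine le_trans ?_ (pureGeometricMeasure_ge h (ψ i))
  have hx1 := norm_inner_vec_le_one T (ψ i)
  have hx0 := norm_nonneg (inner ℂ T.vec (ψ i).vec)
  set x := ‖inner ℂ T.vec (ψ i).vec‖
  have hx2 : x ^ 2 ≤ 1 := pow_le_one₀ hx0 hx1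
  have hs := Real.sq_sqrt (sub_nonneg.mpr hx2)
  have hs0 := Real.sqrt_nonneg (1 - x ^ 2)
  have hs1 : √(1 - x ^ 2) ≤ 1 := Real.sqrt_le_one.mpr (by nlinarith)
  have hd := Real.sq_sqrt hδ
  have hd0 := Real.sqrt_nonneg δ
  have h1 : x ^ 2 * δ ≤ δ := mul_le_of_le_one_left hδ hx2
  have h2 : x * √δ * √(1 - x ^ 2) ≤ √δ := by
    calc x * √δ * √(1 - x ^ 2) ≤ 1 * √δ * 1 := by gcongr
      _ = √δ := by ring
  nlinarith

/-- For the pure state itself the error term 2√δ can be avoided: the overlaps average to 1, so every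
member of positive weight has overlap exactly 1 with `T`. The sharp constant is needed for the exact
value on W states. -/
theorem geometricMeasure_toState_ge {N : ℕ} {T : PureState N} {δ : ℝ} (hδ : 0 ≤ δ)
    (h : ∀ φ : Fin N → EuclideanSpace ℂ (Fin 2), (∀ i, ‖φ i‖ = 1) →
      ‖inner ℂ T.vec (productVec φ)‖ ^ 2 ≤ δ) :
    1 - δ ≤ geometricMeasure N T.toState := by
  refine le_geometricMeasure fun n p ψ hp hp1 hσ => ?_
  have hF : ∑ i, p i * (1 - ‖inner ℂ T.vec (ψ i).vec‖ ^ 2) = 0 := by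
    have h1 := expectation_sum_smul_proj T p ψ
    rw [← hσ] at h1
    have h2 : expectation T T.toState.mat = 1 := by
      change expectation T T.proj = 1
      rw [expectation_proj, inner_self_eq_norm_sq_to_K, T.norm_vec]
      simp
    simp_rw [mul_sub, mul_one, Finset.sum_sub_distrib, hp1, ← h1, h2, sub_self]
  have hz := (Finset.sum_eq_zero_iff_of_nonneg fun i _ => mul_nonneg (hp i)
    (sub_nonneg.mpr (pow_le_one₀ (norm_nonneg _) (norm_inner_vec_le_one T (ψ i))))).mp hF
  calc 1 - δ = ∑ i, p i * (1 - δ) := by rw [← Finset.sum_mul, hp1, one_mul]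
    _ ≤ _ := by
      refine Finset.sum_le_sum fun i _ => ?_
      rcases mul_eq_zero.mp (hz i (Finset.mem_univ i)) with h0 | h0
      · simp [h0]
      · have hx : ‖inner ℂ T.vec (ψ i).vec‖ = 1 := by
          have h3 := norm_nonneg (inner ℂ T.vec (ψ i).vec)
          nlinarith
        have h4 := pureGeometricMeasure_ge h (ψ i)
        rw [h0, hx] at h4
        simp only [Real.sqrt_zero, add_zero, one_mul, Real.sq_sqrt hδ] at h4
        exact mul_le_mul_of_nonneg_left h4 (hp i)

/-! ### Products of Bell pairs -/

theorem sum_prod_castAdd_natAdd {R κ : Type*} [CommSemiring R] [Fintype κ] {m : ℕ}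
    (g : Fin m → κ → κ → R) :
    ∑ x : Fin (m + m) → κ, ∏ i, g i (x (Fin.castAdd m i)) (x (Fin.natAdd m i))
      = ∏ i, ∑ a, ∑ b, g i a b := by
  classical
  rw [← (Fin.appendEquiv m m).sum_comp, Fintype.sum_prod_type]
  simp only [Fin.appendEquiv, Equiv.coe_fn_mk, Fin.append_left, Fin.append_right]
  rw [Finset.prod_univ_sum, Fintype.piFinset_univ]
  refine Finset.sum_congr rfl fun y _ => ?_
  rw [Finset.prod_univ_sum, Fintype.piFinset_univ]

/-- The tensor product of `m` Bell pairs, the `i`-th one shared by the qubits `i` and `m + i`. -/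
noncomputable def bellVec (m : ℕ) : EuclideanSpace ℂ (Bits (m + m)) :=
  WithLp.toLp 2 fun x =>
    ∏ i : Fin m, if x (Fin.castAdd m i) = x (Fin.natAdd m i) then ((1 / √2 : ℝ) : ℂ) else 0

theorem norm_bellVec (m : ℕ) : ‖bellVec m‖ = 1 := by
  have h : ‖bellVec m‖ ^ 2 = 1 := by
    rw [EuclideanSpace.norm_sq_eq]
    simp only [bellVec, norm_prod, ← Finset.prod_pow]
    rw [sum_prod_castAdd_natAdd
      (fun _ a b => ‖if a = b then ((1 / √2 : ℝ) : ℂ) else 0‖ ^ 2)]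
    apply Finset.prod_eq_one
    intro i _
    simp only [Fin.sum_univ_two]
    simp [abs_of_nonneg]
    norm_num
  exact (pow_eq_one_iff_of_nonneg (norm_nonneg _) two_ne_zero).mp h

/-- The state of `m` Bell pairs. -/
noncomputable def bellState (m : ℕ) : PureState (m + m) := ⟨bellVec m, norm_bellVec m⟩

theorem inner_bellVec_productVec {m : ℕ} (φ : Fin (m + m) → EuclideanSpace ℂ (Fin 2)) :
    inner ℂ (bellVec m) (productVec φ) = ∏ i : Fin m, ((1 / √2 : ℝ) : ℂ) *
      ∑ a, φ (Fin.castAdd m i) a * φ (Fin.natAdd m i) a := by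
  have h : inner ℂ (bellVec m) (productVec φ) = ∑ x : Bits (m + m), ∏ i : Fin m,
      (fun i a b => φ (Fin.castAdd m i) a * φ (Fin.natAdd m i) b *
        if a = b then ((1 / √2 : ℝ) : ℂ) else 0) i (x (Fin.castAdd m i)) (x (Fin.natAdd m i)) := by
    rw [PiLp.inner_apply]
    refine Finset.sum_congr rfl fun x _ => ?_
    simp only [bellVec, productVec, RCLike.inner_apply, map_prod, Fin.prod_univ_add,
      ← Finset.prod_mul_distrib]
    refine Finset.prod_congr rfl fun i _ => ?_
    congr 1
    split_ifs
    · rw [Complex.conj_ofReal]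
    · simp
  refine (h.trans (sum_prod_castAdd_natAdd fun i a b => φ (Fin.castAdd m i) a *
    φ (Fin.natAdd m i) b * if a = b then ((1 / √2 : ℝ) : ℂ) else 0)).trans ?_
  refine Finset.prod_congr rfl fun i _ => ?_
  rw [Finset.mul_sum]
  refine Finset.sum_congr rfl fun a _ => ?_
  simp [mul_comm]

theorem norm_sum_mul_le {ι : Type*} [Fintype ι] (u v : EuclideanSpace ℂ ι) :
    ‖∑ a, u a * v a‖ ≤ ‖u‖ * ‖v‖ := by
  have h := norm_inner_le_norm (𝕜 := ℂ) (WithLp.toLp 2 (star u.ofLp) : EuclideanSpace ℂ ι) v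
  rw [EuclideanSpace.norm_eq (WithLp.toLp 2 (star u.ofLp) : EuclideanSpace ℂ ι)] at h
  simp only [Pi.star_apply, norm_star, ← EuclideanSpace.norm_eq] at h
  refine le_trans (le_of_eq ?_) h
  congr 1
  rw [PiLp.inner_apply]
  simp [mul_comm]

/-- `δ` bounds the fidelity of `T` with all factorized vectors. -/
def ProductBound {N : ℕ} (T : EuclideanSpace ℂ (Bits N)) (δ : ℝ) : Prop :=
  ∀ φ : Fin N → EuclideanSpace ℂ (Fin 2),
    ‖inner ℂ T (productVec φ)‖ ^ 2 ≤ δ * ‖productVec φ‖ ^ 2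

theorem ProductBound.of_unit {N : ℕ} {T : EuclideanSpace ℂ (Bits N)} {δ : ℝ}
    (h : ProductBound T δ) (φ : Fin N → EuclideanSpace ℂ (Fin 2)) (hφ : ∀ i, ‖φ i‖ = 1) :
    ‖inner ℂ T (productVec φ)‖ ^ 2 ≤ δ := by
  simpa [norm_productVec, hφ] using h φ

/-- The overlap factorizes over the pairs, and by Cauchy–Schwarz each pair contributes at most 1/2
to its square. -/
theorem productBound_bellVec (m : ℕ) : ProductBound (bellVec m) ((1 / 2) ^ m) := by
  intro φ
  rw [inner_bellVec_productVec, norm_productVec, Fin.prod_univ_add, ← Finset.prod_mul_distrib,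
    norm_prod, ← Finset.prod_pow, ← Finset.prod_pow]
  have h : ((1 / 2 : ℝ)) ^ m = ∏ _i : Fin m, (1 / 2 : ℝ) := by simp
  rw [h, ← Finset.prod_mul_distrib]
  refine Finset.prod_le_prod (fun i _ => by positivity) fun i _ => ?_
  have hs : (1 / √2 : ℝ) ^ 2 = 1 / 2 := by
    rw [div_pow, Real.sq_sqrt (by norm_num), one_pow]
  rw [norm_mul, mul_pow, Complex.norm_real, Real.norm_of_nonneg (by positivity), hs]
  gcongr
  exact norm_sum_mul_le _ _

theorem inner_padVec_productVec {N k : ℕ} (T : EuclideanSpace ℂ (Bits N))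
    (φ : Fin (N + k) → EuclideanSpace ℂ (Fin 2)) :
    inner ℂ (padVec T k) (productVec φ)
      = inner ℂ T (productVec fun i => φ (Fin.castAdd k i)) *
        ∏ j, φ (Fin.natAdd N j) 0 := by
  rw [PiLp.inner_apply, PiLp.inner_apply, Finset.sum_mul, ← (Fin.appendEquiv N k).sum_comp,
    Fintype.sum_prod_type]
  refine Finset.sum_congr rfl fun x _ => ?_
  rw [Finset.sum_eq_single (fun _ => 0)]
  · simp [padVec, productVec, Fin.appendEquiv, Fin.prod_univ_add]
    ring
  · intro y _ hy
    have : ¬ ∀ j : Fin k, y j = 0 := fun h => hy (funext h)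
    simp [padVec, Fin.appendEquiv, this]
  · simp

/-- A padding qubit only multiplies the overlap by the amplitude of its factor at 0, which is at
most the norm of that factor. -/
theorem ProductBound.padVec {N : ℕ} {T : EuclideanSpace ℂ (Bits N)} {δ : ℝ} (hδ : 0 ≤ δ)
    (h : ProductBound T δ) (k : ℕ) : ProductBound (padVec T k) δ := by
  intro φ
  rw [inner_padVec_productVec, norm_mul, mul_pow, norm_productVec, Fin.prod_univ_add, mul_pow,
    ← mul_assoc, norm_prod]
  have h1 := h fun i => φ (Fin.castAdd k i)
  rw [norm_productVec] at h1
  gcongr with j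
  exact PiLp.norm_apply_le _ _

/-! ### Local operators -/

section LocalOp

variable {M : ℕ} {X : Type} [DecidableEq X]

theorem localOp_conjTranspose (k : Fin M) (A : Matrix X X ℂ) :
    (localOp k A)ᴴ = localOp k Aᴴ := by
  ext y x
  simp only [localOp, Matrix.conjTranspose_apply, Matrix.of_apply, eq_comm (a := x _)]
  split_ifs <;> simp

theorem localOp_one (k : Fin M) : localOp k (1 : Matrix X X ℂ) = 1 := by
  ext y x
  rw [Matrix.one_apply]
  simp only [localOp, Matrix.of_apply, Matrix.one_apply]
  by_cases h : y = x
  · subst h; simp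
  · rw [if_neg h]
    split_ifs with h1 h2
    · exact absurd (funext fun i => if hi : i = k then hi ▸ h2 else h1 i hi) h
    · rfl
    · rfl

theorem localOp_sum (k : Fin M) {n : ℕ} (A : Fin n → Matrix X X ℂ) :
    localOp k (∑ j, A j) = ∑ j, localOp k (A j) := by
  ext y x
  simp only [Matrix.sum_apply, localOp, Matrix.of_apply]
  split_ifs <;> simp

variable [Fintype X]

theorem localOp_mulVec_apply (k : Fin M) (A : Matrix X X ℂ) (v : (Fin M → X) → ℂ)
    (y : Fin M → X) :
    (localOp k A *ᵥ v) y = ∑ c, A (y k) c * v (Function.update y k c) := by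
  rw [Matrix.mulVec, dotProduct]
  symm
  refine Fintype.sum_of_injective (fun c => Function.update y k c)
    (Function.update_injective y k) _ _ ?_ ?_
  · intro x hx
    have : ¬ ∀ i, i ≠ k → y i = x i := by
      intro h
      refine hx ⟨x k, funext fun i => ?_⟩
      by_cases hi : i = k
      · subst hi; simp
      · simp [Function.update_of_ne hi, h i hi]
    simp [localOp, this]
  · intro c
    have : ∀ i, i ≠ k → y i = Function.update y k c i := fun i hi => by
      rw [Function.update_of_ne hi]
    simp only [localOp, Matrix.of_apply]
    rw [if_pos this, Function.update_self]

theorem localOp_mul (k : Fin M) (A B : Matrix X X ℂ) :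
    localOp k A * localOp k B = localOp k (A * B) := by
  ext y x
  have h := localOp_mulVec_apply k A (fun z => localOp k B z x) y
  rw [Matrix.mul_apply]
  refine h.trans ?_
  have hc : ∀ c, (∀ i, i ≠ k → Function.update y k c i = x i) ↔ ∀ i, i ≠ k → y i = x i :=
    fun c => forall₂_congr fun i hi => by rw [Function.update_of_ne hi]
  simp only [localOp, Matrix.of_apply, hc, Function.update_self]
  split_ifs <;> simp [Matrix.mul_apply]

/-- The squared Euclidean norm of a vector of amplitudes. -/
noncomputable def normSq {ι : Type*} [Fintype ι] (v : ι → ℂ) : ℝ := ∑ x, ‖v x‖ ^ 2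

theorem star_dotProduct_self_eq_normSq {ι : Type*} [Fintype ι] (v : ι → ℂ) :
    star v ⬝ᵥ v = (normSq v : ℂ) := by
  simp [normSq, dotProduct, Complex.conj_mul']

/-- Conservation of probability in one round: the completeness relation lifts from one party to the
whole system. -/
theorem sum_normSq_localOp_mulVec (k : Fin M) {n : ℕ} (K : Fin n → Matrix X X ℂ)
    (hK : ∑ j, (K j)ᴴ * K j = 1) (v : (Fin M → X) → ℂ) :
    ∑ j, normSq (localOp k (K j) *ᵥ v) = normSq v := by
  have h : ∑ j, (localOp k (K j))ᴴ * localOp k (K j) = 1 := by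
    simp_rw [localOp_conjTranspose, localOp_mul]
    rw [← localOp_sum, hK, localOp_one]
  have h2 : (∑ j, (normSq (localOp k (K j) *ᵥ v) : ℂ)) = (normSq v : ℂ) := by
    simp_rw [← star_dotProduct_self_eq_normSq, Matrix.star_mulVec, ← Matrix.dotProduct_mulVec,
      Matrix.mulVec_mulVec, ← dotProduct_sum, ← Matrix.sum_mulVec, h, Matrix.one_mulVec]
  exact_mod_cast h2

/-- The multiples of factorized vectors. -/
def IsFactorized (v : (Fin M → X) → ℂ) : Prop :=
  ∃ (c : ℂ) (f : Fin M → X → ℂ), v = c • fun x => ∏ i, f i (x i)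

theorem IsFactorized.localOp_mulVec {v : (Fin M → X) → ℂ} (hv : IsFactorized v) (k : Fin M)
    (A : Matrix X X ℂ) : IsFactorized (localOp k A *ᵥ v) := by
  obtain ⟨c, f, rfl⟩ := hv
  refine ⟨c, Function.update f k (A *ᵥ f k), ?_⟩
  rw [Matrix.mulVec_smul]
  congr 1
  funext y
  rw [localOp_mulVec_apply, ← Finset.mul_prod_erase _ _ (Finset.mem_univ k),
    Function.update_self, Matrix.mulVec, dotProduct, Finset.sum_mul]
  refine Finset.sum_congr rfl fun c _ => ?_
  rw [← Finset.mul_prod_erase _ _ (Finset.mem_univ k), Function.update_self, mul_assoc]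
  congr 2
  refine Finset.prod_congr rfl fun i hi => ?_
  rw [Function.update_of_ne (Finset.ne_of_mem_erase hi),
    Function.update_of_ne (Finset.ne_of_mem_erase hi)]

/-! ### Running a protocol on a pure state -/

/-- The sum over all measurement records of the weights `w` of the unnormalized output vectors. -/
noncomputable def LOCCTree.weight {r : ℕ} (w : ((Fin M → X) → ℂ) → ℝ) :
    LOCCTree M X r → ((Fin M → X) → ℂ) → ℝ
  | .done _, v => w v
  | .measure k _ K _ next, v => ∑ j, (next j).weight w (localOp k (K j) *ᵥ v)

/-- A bound on a class of vectors stable under local operators passes from the leaves of the tree to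
its root, because each round preserves the total squared norm. -/
theorem LOCCTree.weight_le_mul_normSq {r : ℕ} {w : ((Fin M → X) → ℂ) → ℝ}
    {P : ((Fin M → X) → ℂ) → Prop} {C : ℝ}
    (hP : ∀ k A v, P v → P (localOp k A *ᵥ v)) (hw : ∀ v, P v → w v ≤ C * normSq v)
    (t : LOCCTree M X r) : ∀ v, P v → t.weight w v ≤ C * normSq v := by
  induction t with
  | done i => exact hw
  | measure k n K hK next ih =>
    intro v hv
    rw [LOCCTree.weight, ← sum_normSq_localOp_mulVec k K hK v, Finset.mul_sum]
    exact Finset.sum_le_sum fun j _ => ih j _ (hP k _ v hv)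

theorem LOCCTree.weight_add_le {r : ℕ} {w : ((Fin M → X) → ℂ) → ℝ} {a b : ℝ}
    (hw : ∀ u v, w (u + v) ≤ a * w u + b * w v) (t : LOCCTree M X r) :
    ∀ u v, t.weight w (u + v) ≤ a * t.weight w u + b * t.weight w v := by
  induction t with
  | done i => exact hw
  | measure k n K hK next ih =>
    intro u v
    simp only [LOCCTree.weight, Matrix.mulVec_add, Finset.mul_sum, ← Finset.sum_add_distrib]
    exact Finset.sum_le_sum fun j _ => ih j _ _

theorem LOCCTree.run_posSemidef {r : ℕ} (t : LOCCTree M X r) :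
    ∀ {τ : Matrix (Fin M → X) (Fin M → X) ℂ}, τ.PosSemidef → ∀ i, (t.run τ i).PosSemidef := by
  induction t with
  | done i₀ =>
    intro τ hτ i
    rw [LOCCTree.run]
    split_ifs
    · exact hτ
    · exact Matrix.PosSemidef.zero
  | measure k n K hK next ih =>
    intro τ hτ i
    rw [LOCCTree.run]
    exact Matrix.posSemidef_sum _ fun j _ => ih j (hτ.mul_mul_conjTranspose_same _) i

/-- Summing an additive functional over all final outcomes makes the merging of measurement records
irrelevant. Each record maps a rank-one matrix to a rank-one matrix, so it is enough to follow
vectors. -/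
theorem LOCCTree.sum_run_vecMulVec {r : ℕ}
    (L : Matrix (Fin M → X) (Fin M → X) ℂ →+ ℝ) (t : LOCCTree M X r) :
    ∀ v : (Fin M → X) → ℂ, ∑ i, L (t.run (Matrix.vecMulVec v (star v)) i)
      = t.weight (fun v => L (Matrix.vecMulVec v (star v))) v := by
  induction t with
  | done i₀ =>
    intro v
    simp only [LOCCTree.run, LOCCTree.weight]
    rw [Finset.sum_eq_single i₀ (fun i _ hi => by simp [hi]) (by simp)]
    simp
  | measure k n K hK next ih =>
    intro v
    simp only [LOCCTree.run, LOCCTree.weight, map_sum]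
    rw [Finset.sum_comm]
    refine Finset.sum_congr rfl fun j _ => ?_
    rw [← ih j, Matrix.mul_vecMulVec, Matrix.vecMulVec_mul, Matrix.star_mulVec]

end LocalOp

/-! ### Ancillas -/

section Ancillas

variable {M : ℕ} {a : ℕ}

/-- The component of `v` with ancillas in the basis state `s`. -/
noncomputable def ancillaSlice (v : (Fin M → Fin 2 × Fin (a + 1)) → ℂ) (s : Fin M → Fin (a + 1)) :
    EuclideanSpace ℂ (Bits M) :=
  WithLp.toLp 2 fun x => v fun i => (x i, s i)

/-- The vector `|v⟩ ⊗ |0⟩`, with all ancillas in the state `|0⟩`. -/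
def withAncillas (a : ℕ) (v : EuclideanSpace ℂ (Bits M)) : (Fin M → Fin 2 × Fin (a + 1)) → ℂ :=
  fun x => if ∀ i, (x i).2 = 0 then v fun i => (x i).1 else 0

theorem sum_norm_ancillaSlice_sq (v : (Fin M → Fin 2 × Fin (a + 1)) → ℂ) :
    ∑ s, ‖ancillaSlice v s‖ ^ 2 = normSq v := by
  simp only [EuclideanSpace.norm_sq_eq, normSq]
  rw [← (Equiv.arrowProdEquivProdArrow (Fin M) (fun _ => Fin 2)
    (fun _ => Fin (a + 1))).symm.sum_comp, Fintype.sum_prod_type, Finset.sum_comm]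
  rfl

theorem normSq_withAncillas (v : EuclideanSpace ℂ (Bits M)) :
    normSq (withAncillas a v) = ‖v‖ ^ 2 := by
  rw [← sum_norm_ancillaSlice_sq, Finset.sum_eq_single fun _ => 0]
  · simp [ancillaSlice, withAncillas]
  · intro s _ hs
    have : ¬ ∀ i, s i = 0 := fun h => hs (funext h)
    simp [ancillaSlice, withAncillas, this, EuclideanSpace.norm_sq_eq]
  · simp

theorem withAncillas_add (u v : EuclideanSpace ℂ (Bits M)) :
    withAncillas a (u + v) = withAncillas a u + withAncillas a v := by
  funext x
  simp only [withAncillas, Pi.add_apply, PiLp.add_apply]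
  split_ifs <;> simp

theorem isFactorized_withAncillas (c : ℂ) (φ : Fin M → EuclideanSpace ℂ (Fin 2)) :
    IsFactorized (withAncillas a (c • productVec φ)) := by
  refine ⟨c, fun i p => if p.2 = 0 then φ i p.1 else 0, ?_⟩
  funext x
  simp only [withAncillas, productVec, Pi.smul_apply, PiLp.smul_apply, Finset.prod_ite_zero,
    Finset.mem_univ, true_imp_iff, smul_eq_mul]
  split_ifs <;> simp

theorem addAncillas_vecMulVec (v : EuclideanSpace ℂ (Bits M)) :
    addAncillas a (Matrix.vecMulVec v.ofLp (star v.ofLp))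
      = Matrix.vecMulVec (withAncillas a v) (star (withAncillas a v)) := by
  ext x y
  simp only [addAncillas, withAncillas, Matrix.of_apply, Matrix.vecMulVec_apply, Pi.star_apply]
  by_cases hx : ∀ i, (x i).2 = 0 <;> by_cases hy : ∀ i, (y i).2 = 0 <;> simp [hx, hy]

theorem traceAncillas_posSemidef
    {τ : Matrix (Fin M → Fin 2 × Fin (a + 1)) (Fin M → Fin 2 × Fin (a + 1)) ℂ}
    (hτ : τ.PosSemidef) : (traceAncillas a τ).PosSemidef := by
  have h : traceAncillas a τ = ∑ s : Fin M → Fin (a + 1),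
      τ.submatrix (fun x i => (x i, s i)) (fun x i => (x i, s i)) := by
    ext x y
    simp [traceAncillas, Matrix.sum_apply]
  rw [h]
  exact Matrix.posSemidef_sum _ fun s _ => hτ.submatrix _

/-- `τ ↦ ⟨T| tr_anc τ |T⟩`. -/
noncomputable def ancillaExpectation (a : ℕ) (T : PureState M) :
    Matrix (Fin M → Fin 2 × Fin (a + 1)) (Fin M → Fin 2 × Fin (a + 1)) ℂ →+ ℝ where
  toFun τ := expectation T (traceAncillas a τ)
  map_zero' := by
    have : traceAncillas a (0 : Matrix (Fin M → Fin 2 × Fin (a + 1)) _ ℂ) = 0 := by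
      ext x y; simp [traceAncillas]
    simp [this, expectation]
  map_add' τ τ' := by
    have : traceAncillas a (τ + τ') = traceAncillas a τ + traceAncillas a τ' := by
      ext x y; simp [traceAncillas, Finset.sum_add_distrib]
    simp [this, expectation, Matrix.add_mulVec, dotProduct_add]

theorem ancillaExpectation_vecMulVec (T : PureState M)
    (v : (Fin M → Fin 2 × Fin (a + 1)) → ℂ) :
    ancillaExpectation a T (Matrix.vecMulVec v (star v))
      = ∑ s, ‖inner ℂ T.vec (ancillaSlice v s)‖ ^ 2 := by
  have h : traceAncillas a (Matrix.vecMulVec v (star v)) = ∑ s,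
      Matrix.vecMulVec (ancillaSlice v s).ofLp (star (ancillaSlice v s).ofLp) := by
    ext x y
    simp [traceAncillas, Matrix.sum_apply, ancillaSlice, Matrix.vecMulVec_apply]
  change expectation T (traceAncillas a _) = _
  rw [h, expectation, Matrix.sum_mulVec, dotProduct_sum, Complex.re_sum]
  simp_rw [star_dotProduct_vecMulVec_mulVec, Complex.ofReal_re]

theorem ancillaExpectation_le_normSq (T : PureState M) (v : (Fin M → Fin 2 × Fin (a + 1)) → ℂ) :
    ancillaExpectation a T (Matrix.vecMulVec v (star v)) ≤ 1 * normSq v := by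
  rw [ancillaExpectation_vecMulVec, one_mul, ← sum_norm_ancillaSlice_sq]
  gcongr with s
  simpa [T.norm_vec] using norm_inner_le_norm (𝕜 := ℂ) T.vec (ancillaSlice v s)

/-- Fixing the basis states of the ancillas in a factorized vector leaves a multiple of a product
vector of qubits. Its factors are not normalized, which is why `ProductBound` is stated
homogeneously. -/
theorem ancillaExpectation_le_of_isFactorized {T : PureState M} {δ : ℝ}
    (hT : ProductBound T.vec δ) {v : (Fin M → Fin 2 × Fin (a + 1)) → ℂ} (hv : IsFactorized v) :
    ancillaExpectation a T (Matrix.vecMulVec v (star v)) ≤ δ * normSq v := by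
  obtain ⟨c, f, rfl⟩ := hv
  rw [ancillaExpectation_vecMulVec, ← sum_norm_ancillaSlice_sq, Finset.mul_sum]
  refine Finset.sum_le_sum fun s _ => ?_
  have h : ancillaSlice (c • fun x => ∏ i, f i (x i)) s
      = c • productVec fun i => WithLp.toLp 2 fun b => f i (b, s i) := by
    ext x
    simp [ancillaSlice, productVec]
  rw [h, inner_smul_right, norm_mul, norm_smul, mul_pow, mul_pow, mul_left_comm]
  exact mul_le_mul_of_nonneg_left (hT _) (by positivity)

/-- This is |x + y|² ≤ (1 + t)|x|² + (1 + 1/t)|y|² with t = 1/2. The symmetric choice t = 1 would be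
too weak for W states, as 2(1 - 1/e) > 1. -/
theorem ancillaExpectation_add_le (T : PureState M)
    (u v : (Fin M → Fin 2 × Fin (a + 1)) → ℂ) :
    ancillaExpectation a T (Matrix.vecMulVec (u + v) (star (u + v)))
      ≤ 3 / 2 * ancillaExpectation a T (Matrix.vecMulVec u (star u))
        + 3 * ancillaExpectation a T (Matrix.vecMulVec v (star v)) := by
  simp only [ancillaExpectation_vecMulVec, Finset.mul_sum, ← Finset.sum_add_distrib]
  refine Finset.sum_le_sum fun s _ => ?_
  have h : ancillaSlice (u + v) s = ancillaSlice u s + ancillaSlice v s := rfl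
  rw [h, inner_add_right]
  have h1 := norm_add_le (inner ℂ T.vec (ancillaSlice u s)) (inner ℂ T.vec (ancillaSlice v s))
  have h2 := norm_nonneg (inner ℂ T.vec (ancillaSlice u s) + inner ℂ T.vec (ancillaSlice v s))
  nlinarith [sq_nonneg (‖inner ℂ T.vec (ancillaSlice u s)‖
    - 2 * ‖inner ℂ T.vec (ancillaSlice v s)‖)]

end Ancillas

/-! ### Protocols -/

section Protocols

variable {M : ℕ}

/-- If `ψ` has a large overlap with a factorized state, no protocol turns it, on average, into
states close to a state `T` that has only small overlaps with factorized states. -/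
theorem LOCCProtocol.sum_expectation_output_le (Λ : LOCCProtocol M) {ψ T : PureState M} {δ q : ℝ}
    (hδ : 0 ≤ δ) (hT : ProductBound T.vec δ) {φ : Fin M → EuclideanSpace ℂ (Fin 2)}
    (hφ : ∀ i, ‖φ i‖ = 1) (hq : q ≤ ‖inner ℂ ψ.vec (productVec φ)‖ ^ 2) :
    ∑ i, expectation T (Λ.output ψ.toState i) ≤ 3 / 2 * (1 - q) + 3 * δ := by
  have hΦ : ‖productVec φ‖ = 1 := by simp [norm_productVec, hφ]
  set c := inner ℂ (productVec φ) ψ.vec with hc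
  have hcn : ‖c‖ = ‖inner ℂ ψ.vec (productVec φ)‖ := norm_inner_symm _ _
  have hsplit : ψ.vec = (ψ.vec - c • productVec φ) + c • productVec φ := by simp
  have hperp : ‖ψ.vec - c • productVec φ‖ ^ 2 = 1 - ‖c‖ ^ 2 := by
    rw [norm_sub_sq (𝕜 := ℂ), ψ.norm_vec, norm_smul, hΦ, inner_smul_right,
      ← inner_conj_symm ψ.vec, ← hc, RCLike.mul_conj]
    norm_cast
    ring
  have hc1 : ‖c‖ ^ 2 ≤ 1 := by nlinarith [sq_nonneg ‖ψ.vec - c • productVec φ‖]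
  have hsum : ∑ i, expectation T (Λ.output ψ.toState i)
      = Λ.tree.weight (fun v => ancillaExpectation Λ.ancilla T (Matrix.vecMulVec v (star v)))
        (withAncillas Λ.ancilla ψ.vec) := by
    rw [← LOCCTree.sum_run_vecMulVec, ← addAncillas_vecMulVec]
    rfl
  rw [hsum, hsplit, withAncillas_add]
  refine (Λ.tree.weight_add_le (ancillaExpectation_add_le T) _ _).trans ?_
  have h1 := Λ.tree.weight_le_mul_normSq (P := fun _ => True) (fun _ _ _ _ => trivial)
    (fun v _ => ancillaExpectation_le_normSq T v)
    (withAncillas Λ.ancilla (ψ.vec - c • productVec φ)) trivial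
  have h2 := Λ.tree.weight_le_mul_normSq (fun k A v hv => IsFactorized.localOp_mulVec hv k A)
    (fun v hv => ancillaExpectation_le_of_isFactorized hT hv)
    (withAncillas Λ.ancilla (c • productVec φ)) (isFactorized_withAncillas c φ)
  rw [normSq_withAncillas, hperp] at h1
  rw [normSq_withAncillas, norm_smul, hΦ, mul_one] at h2
  have h3 : δ * ‖c‖ ^ 2 ≤ δ := mul_le_of_le_one_right hδ hc1
  rw [← hcn] at hq
  linarith

theorem LOCCProtocol.output_posSemidef (Λ : LOCCProtocol M) (ψ : PureState M)
    (i : Fin Λ.outcomes) : (Λ.output ψ.toState i).PosSemidef := by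
  refine traceAncillas_posSemidef (LOCCTree.run_posSemidef _ ?_ _)
  change (addAncillas Λ.ancilla (Matrix.vecMulVec ψ.vec.ofLp (star ψ.vec.ofLp))).PosSemidef
  rw [addAncillas_vecMulVec]
  exact Matrix.posSemidef_vecMulVec_self_star _

theorem LOCCProtocol.prob_nonneg (Λ : LOCCProtocol M) (ψ : PureState M) (i : Fin Λ.outcomes) :
    0 ≤ Λ.prob ψ.toState i :=
  (Complex.nonneg_iff.mp (Λ.output_posSemidef ψ i).trace_nonneg).1

/-- Failing branches are discarded, which is harmless since their expectation values are
nonnegative. -/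
theorem LOCCProtocol.mul_successProb_le (Λ : LOCCProtocol M) {D : StateDistance} {ε c : ℝ}
    (ψ T : PureState M) (h : ∀ ρ : State M, D.val ρ T.toState ≤ ε → c ≤ expectation T ρ.mat) :
    c * Λ.successProb D ε ψ.toState T.toState ≤ ∑ i, expectation T (Λ.output ψ.toState i) := by
  rw [LOCCProtocol.successProb, Finset.mul_sum]
  refine Finset.sum_le_sum fun i _ => ?_
  split_ifs with hi
  · obtain ⟨ρ, hρ, hD⟩ := hi
    have he : expectation T (Λ.output ψ.toState i)
        = Λ.prob ψ.toState i * expectation T ρ.mat := by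
      rw [hρ, expectation, Matrix.smul_mulVec, dotProduct_smul, smul_eq_mul,
        Complex.re_ofReal_mul, expectation]
    rw [he, mul_comm]
    exact mul_le_mul_of_nonneg_left (h ρ hD) (Λ.prob_nonneg ψ i)
  · rw [mul_zero]
    exact expectation_nonneg T (Λ.output_posSemidef ψ i)

end Protocols

/-! ### The optimization problem for W states -/

section Excitation

variable {ι : Type*} [DecidableEq ι]

/-- `∑ᵢ sin θᵢ ∏_{j ≠ i} cos θⱼ`, over a finite set of indices. -/
noncomputable def excitationSum (s : Finset ι) (θ : ι → ℝ) : ℝ :=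
  ∑ i ∈ s, Real.sin (θ i) * ∏ j ∈ s.erase i, Real.cos (θ j)

theorem excitationSum_insert {s : Finset ι} {a : ι} (ha : a ∉ s) (θ : ι → ℝ) :
    excitationSum (insert a s) θ = Real.sin (θ a) * ∏ j ∈ s, Real.cos (θ j)
      + Real.cos (θ a) * excitationSum s θ := by
  rw [excitationSum, Finset.sum_insert ha, Finset.erase_insert ha, excitationSum, Finset.mul_sum]
  congr 1
  refine Finset.sum_congr rfl fun i hi => ?_
  have hai : a ≠ i := fun h => ha (h ▸ hi)
  rw [Finset.erase_insert_of_ne hai, Finset.prod_insert fun h => ha (Finset.mem_of_mem_erase h)]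
  ring

theorem excitationSum_congr {s : Finset ι} {θ θ' : ι → ℝ} (h : ∀ i ∈ s, θ i = θ' i) :
    excitationSum s θ = excitationSum s θ' := by
  refine Finset.sum_congr rfl fun i hi => ?_
  rw [h i hi]
  congr 1
  exact Finset.prod_congr rfl fun j hj => by rw [h j (Finset.mem_of_mem_erase hj)]

theorem excitationSum_nonneg {s : Finset ι} {θ : ι → ℝ}
    (h : ∀ i, θ i ∈ Set.Icc 0 (Real.pi / 2)) : 0 ≤ excitationSum s θ := by
  have hπ := Real.pi_pos
  refine Finset.sum_nonneg fun i _ => mul_nonneg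
    (Real.sin_nonneg_of_nonneg_of_le_pi (h i).1 (by linarith [(h i).2])) ?_
  exact Finset.prod_nonneg fun j _ =>
    Real.cos_nonneg_of_neg_pi_div_two_le_of_le (by linarith [(h j).1]) (h j).2

/-- Two of the angles enter only through their sum and the product of their cosines; this isolates
what averaging them changes. -/
theorem excitationSum_pair {s : Finset ι} {i j : ι} (hij : i ≠ j) (hi : i ∉ s) (hj : j ∉ s)
    (θ : ι → ℝ) :
    excitationSum (insert i (insert j s)) θ
      = Real.sin (θ i + θ j) * ∏ l ∈ s, Real.cos (θ l)
        + Real.cos (θ i) * Real.cos (θ j) * excitationSum s θ := by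
  rw [excitationSum_insert (by simp [hij, hi]), excitationSum_insert hj, Finset.prod_insert hj,
    Real.sin_add]
  ring

/-- Averaging two different angles increases the sum, unless it is at most `1`. -/
theorem excitationSum_le_one_of_isMaxOn [Fintype ι] {θ : ι → ℝ}
    (hθ : ∀ i, θ i ∈ Set.Icc 0 (Real.pi / 2))
    (hmax : ∀ θ' : ι → ℝ, (∀ i, θ' i ∈ Set.Icc 0 (Real.pi / 2)) →
      excitationSum Finset.univ θ' ≤ excitationSum Finset.univ θ)
    {i j : ι} (hij : θ i ≠ θ j) : excitationSum Finset.univ θ ≤ 1 := by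
  have hne : i ≠ j := fun h => hij (h ▸ rfl)
  set s : Finset ι := (Finset.univ.erase i).erase j with hs
  have hi : i ∉ s := by simp [hs]
  have hj : j ∉ s := by simp [hs]
  have huniv : (Finset.univ : Finset ι) = insert i (insert j s) := by
    rw [hs, Finset.insert_erase (by simp [hne.symm]), Finset.insert_erase (Finset.mem_univ i)]
  set m := (θ i + θ j) / 2 with hm
  let θ' : ι → ℝ := Function.update (Function.update θ i m) j m
  have hi' : θ' i = m := by simp [θ', Function.update_of_ne hne]
  have hj' : θ' j = m := by simp [θ']
  have hs' : ∀ l ∈ s, θ' l = θ l := fun l hl => by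
    have h1 : l ≠ i := fun h => hi (h ▸ hl)
    have h2 : l ≠ j := fun h => hj (h ▸ hl)
    simp [θ', Function.update_of_ne h1, Function.update_of_ne h2]
  have hθ' : ∀ l, θ' l ∈ Set.Icc 0 (Real.pi / 2) := by
    intro l
    have hmI : m ∈ Set.Icc 0 (Real.pi / 2) := by
      constructor <;> linarith [(hθ i).1, (hθ j).1, (hθ i).2, (hθ j).2]
    by_cases h2 : l = j
    · rw [h2, hj']; exact hmI
    by_cases h1 : l = i
    · rw [h1, hi']; exact hmI
    simpa [θ', Function.update_of_ne h1, Function.update_of_ne h2] using hθ l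
  have hle := hmax θ' hθ'
  rw [huniv, excitationSum_pair hne hi hj, excitationSum_pair hne hi hj, hi', hj',
    excitationSum_congr hs', Finset.prod_congr rfl fun l hl => by rw [hs' l hl]] at hle
  have hmm : m + m = θ i + θ j := by rw [hm]; ring
  rw [hmm] at hle
  -- With d half the difference of the angles, cos(m + d) cos(m - d) = cos² m - sin² d, and sin d ≠
  -- 0 because 0 < |d| < π.
  have hcos : Real.cos (θ i) * Real.cos (θ j) < Real.cos m * Real.cos m := by
    have h1 : Real.cos (θ i) = Real.cos (m + (θ i - θ j) / 2) := by congr 1; rw [hm]; ring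
    have h2 : Real.cos (θ j) = Real.cos (m - (θ i - θ j) / 2) := by congr 1; rw [hm]; ring
    have h3 : Real.sin ((θ i - θ j) / 2) ≠ 0 := by
      intro h
      have := (Real.sin_eq_zero_iff_of_lt_of_lt
        (by linarith [(hθ i).1, (hθ j).2, Real.pi_pos])
        (by linarith [(hθ i).2, (hθ j).1, Real.pi_pos])).mp h
      exact hij (by linarith)
    rw [h1, h2, Real.cos_add, Real.cos_sub]
    have h4 := Real.sin_sq_add_cos_sq m
    have h5 := Real.sin_sq_add_cos_sq ((θ i - θ j) / 2)
    have h6 : 0 < Real.sin ((θ i - θ j) / 2) ^ 2 := by positivity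
    nlinarith
  -- Averaging keeps the sine term and strictly increases the coefficient of `excitationSum s θ`, so
  -- maximality forces this nonnegative quantity to vanish.
  have hB : excitationSum s θ = 0 := by
    have hB0 := excitationSum_nonneg (s := s) hθ
    nlinarith
  rw [huniv, excitationSum_pair hne hi hj, hB, mul_zero, add_zero]
  have hcn : ∀ l, 0 ≤ Real.cos (θ l) := fun l =>
    Real.cos_nonneg_of_neg_pi_div_two_le_of_le (by linarith [(hθ l).1, Real.pi_pos]) (hθ l).2
  have hA1 : ∏ l ∈ s, Real.cos (θ l) ≤ 1 :=
    Finset.prod_le_one (fun l _ => hcn l) fun l _ => Real.cos_le_one _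
  have hA0 : 0 ≤ ∏ l ∈ s, Real.cos (θ l) := Finset.prod_nonneg fun l _ => hcn l
  calc _ ≤ 1 * ∏ l ∈ s, Real.cos (θ l) :=
        mul_le_mul_of_nonneg_right (Real.sin_le_one _) hA0
    _ ≤ 1 := by rw [one_mul]; exact hA1

end Excitation

/-- Two uses of 1 + y ≤ exp y: 1 - p ≤ exp(-p) and np ≤ exp(np - 1). The exponentials then cancel.
-/
theorem mul_one_sub_pow_le {p : ℝ} (hp : p ≤ 1) {n : ℕ} (hn : 0 < n) :
    p * (1 - p) ^ n ≤ 1 / (n * Real.exp 1) := by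
  have hn' : (0 : ℝ) < n := by exact_mod_cast hn
  rw [le_div_iff₀ (by positivity)]
  have h1 : (1 - p) ^ n ≤ Real.exp (-(n * p)) := by
    rw [← mul_neg, Real.exp_nat_mul]
    exact pow_le_pow_left₀ (by linarith) (by linarith [Real.add_one_le_exp (-p)]) n
  have h0 : 0 ≤ (1 - p) ^ n := pow_nonneg (by linarith) n
  have h2 : n * p ≤ Real.exp (n * p - 1) := by linarith [Real.add_one_le_exp (n * p - 1)]
  calc p * (1 - p) ^ n * (n * Real.exp 1) = (n * p) * ((1 - p) ^ n * Real.exp 1) := by ring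
    _ ≤ Real.exp (n * p - 1) * ((1 - p) ^ n * Real.exp 1) :=
        mul_le_mul_of_nonneg_right h2 (by positivity)
    _ ≤ Real.exp (n * p - 1) * (Real.exp (-(n * p)) * Real.exp 1) := by gcongr
    _ = 1 := by rw [← Real.exp_add, ← Real.exp_add]; simp

/-- By compactness a maximizer exists. If its angles are all equal, the one-variable bound applies
with p = sin²; otherwise averaging two of them shows that the maximum is at most 1. -/
theorem excitationSum_sq_le {n : ℕ} (hn : 2 ≤ n) {θ : Fin (n + 1) → ℝ}
    (hθ : ∀ i, θ i ∈ Set.Icc 0 (Real.pi / 2)) :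
    excitationSum Finset.univ θ ^ 2 ≤ (n + 1 : ℝ) ^ 2 / (n * Real.exp 1) := by
  have hn' : (2 : ℝ) ≤ n := by exact_mod_cast hn
  have hcompact : IsCompact (Set.univ.pi fun _ : Fin (n + 1) => Set.Icc 0 (Real.pi / 2)) :=
    isCompact_univ_pi fun _ => isCompact_Icc
  obtain ⟨θm, hθm, hmax⟩ := hcompact.exists_isMaxOn ⟨θ, fun i _ => hθ i⟩
    (f := excitationSum Finset.univ) (by unfold excitationSum; fun_prop)
  have hθm' : ∀ i, θm i ∈ Set.Icc 0 (Real.pi / 2) := fun i => hθm i trivial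
  have h0 := excitationSum_nonneg (s := Finset.univ) hθ
  have hle : excitationSum Finset.univ θ ≤ excitationSum Finset.univ θm :=
    hmax (show θ ∈ _ from fun i _ => hθ i)
  refine (pow_le_pow_left₀ h0 hle 2).trans ?_
  by_cases heq : ∀ i, θm i = θm 0
  · have hval : excitationSum Finset.univ θm
        = (n + 1) * (Real.sin (θm 0) * Real.cos (θm 0) ^ n) := by
      rw [excitationSum_congr (θ' := fun _ => θm 0) fun i _ => heq i]
      simp [excitationSum]
    have h := mul_one_sub_pow_le (Real.sin_sq_le_one (θm 0)) (n := n) (by lia)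
    have hc : 1 - Real.sin (θm 0) ^ 2 = Real.cos (θm 0) ^ 2 := by
      linarith [Real.sin_sq_add_cos_sq (θm 0)]
    rw [hc] at h
    rw [hval, div_eq_mul_one_div]
    calc _ = ((n : ℝ) + 1) ^ 2 * (Real.sin (θm 0) ^ 2 * (Real.cos (θm 0) ^ 2) ^ n) := by ring
      _ ≤ _ := by gcongr
  · push Not at heq
    obtain ⟨i, hi⟩ := heq
    have h1 := excitationSum_le_one_of_isMaxOn hθm'
      (fun θ' h' => hmax (show θ' ∈ _ from fun i _ => h' i)) hi
    calc _ ≤ (1 : ℝ) := pow_le_one₀ (excitationSum_nonneg hθm') h1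
      _ ≤ _ := by
        -- The bound exceeds 1 since n·e < 3n < (n + 1)².
        rw [le_div_iff₀ (by positivity), one_mul]
        nlinarith [Real.exp_one_lt_three]

/-! ### The geometric measure of W states -/

theorem inner_wVec_productVec {N : ℕ} (φ : Fin N → EuclideanSpace ℂ (Fin 2)) :
    inner ℂ (wVec N) (productVec φ)
      = ((1 / √N : ℝ) : ℂ) * ∑ i, φ i 1 * ∏ j ∈ Finset.univ.erase i, φ j 0 := by
  rw [wVec, inner_smul_left, Complex.conj_ofReal, sum_inner]
  congr 1
  refine Finset.sum_congr rfl fun i _ => ?_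
  rw [excitation, EuclideanSpace.inner_single_left, map_one, one_mul]
  change ∏ j, φ j ((Pi.single i 1 : Bits N) j) = _
  rw [← Finset.mul_prod_erase _ _ (Finset.mem_univ i), Pi.single_eq_same]
  congr 1
  exact Finset.prod_congr rfl fun j hj => by rw [Pi.single_eq_of_ne (Finset.ne_of_mem_erase hj)]

theorem norm_inner_wVec_productVec_sq_le {n : ℕ} (hn : 2 ≤ n)
    {φ : Fin (n + 1) → EuclideanSpace ℂ (Fin 2)} (hφ : ∀ i, ‖φ i‖ = 1) :
    ‖inner ℂ (wVec (n + 1)) (productVec φ)‖ ^ 2 ≤ (1 + 1 / n) * (1 / Real.exp 1) := by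
  have hn' : (0 : ℝ) < n := by exact_mod_cast (by lia : 0 < n)
  have hsq : ∀ i, ‖φ i 0‖ ^ 2 + ‖φ i 1‖ ^ 2 = 1 := fun i => by
    have h := EuclideanSpace.norm_sq_eq (φ i)
    rw [hφ, Fin.sum_univ_two] at h
    linarith
  have hle : ∀ i, ‖φ i 1‖ ≤ 1 := fun i => hφ i ▸ PiLp.norm_apply_le (φ i) 1
  -- The moduli of the two amplitudes of each factor become the cosine and sine of one angle; the
  -- phases are lost in the triangle inequality below.
  let θ : Fin (n + 1) → ℝ := fun i => Real.arcsin ‖φ i 1‖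
  have hsin : ∀ i, Real.sin (θ i) = ‖φ i 1‖ := fun i =>
    Real.sin_arcsin (by linarith [norm_nonneg (φ i 1)]) (hle i)
  have hcos : ∀ i, Real.cos (θ i) = ‖φ i 0‖ := fun i => by
    rw [Real.cos_arcsin, ← hsq i, add_sub_cancel_right, Real.sqrt_sq (norm_nonneg _)]
  have hθ : ∀ i, θ i ∈ Set.Icc 0 (Real.pi / 2) := fun i =>
    ⟨Real.arcsin_nonneg.mpr (norm_nonneg _), Real.arcsin_le_pi_div_two _⟩
  have hsum : ‖∑ i, φ i 1 * ∏ j ∈ Finset.univ.erase i, φ j 0‖ ≤ excitationSum Finset.univ θ := by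
    refine (norm_sum_le _ _).trans (le_of_eq ?_)
    simp only [excitationSum, hsin, hcos, norm_mul, norm_prod]
  rw [inner_wVec_productVec, norm_mul, mul_pow, Complex.norm_real,
    Real.norm_of_nonneg (by positivity), div_pow, Real.sq_sqrt (by positivity), one_pow]
  calc _ ≤ 1 / ((n + 1 : ℕ) : ℝ) * ((n + 1 : ℝ) ^ 2 / (n * Real.exp 1)) := by
        gcongr
        exact (pow_le_pow_left₀ (norm_nonneg _) hsum 2).trans (excitationSum_sq_le hn hθ)
    _ = _ := by
        push_cast
        field_simp

theorem inv_exp_one_le_pow (n : ℕ) : 1 / Real.exp 1 ≤ ((n : ℝ) / (n + 1)) ^ n := by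
  rcases Nat.eq_zero_or_pos n with rfl | hn
  · simpa using inv_le_one_of_one_le₀ (Real.one_le_exp zero_le_one)
  have hn' : (0 : ℝ) < n := by exact_mod_cast hn
  have h1 : (((n : ℝ) + 1) / n) ^ n ≤ Real.exp 1 := by
    calc (((n : ℝ) + 1) / n) ^ n ≤ Real.exp (1 / n) ^ n := by
          gcongr
          rw [add_div, div_self hn'.ne']
          linarith [Real.add_one_le_exp (1 / (n : ℝ))]
      _ = Real.exp 1 := by
          rw [← Real.exp_nat_mul, mul_one_div_cancel hn'.ne']
  rw [← inv_div (_ + 1), inv_pow, ← one_div]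
  gcongr

theorem exists_inv_exp_one_le_norm_inner_wVec {N : ℕ} (hN : 0 < N) :
    ∃ φ : Fin N → EuclideanSpace ℂ (Fin 2), (∀ i, ‖φ i‖ = 1) ∧
      1 / Real.exp 1 ≤ ‖inner ℂ (wVec N) (productVec φ)‖ ^ 2 := by
  obtain ⟨n, rfl⟩ : ∃ n, N = n + 1 := ⟨N - 1, by lia⟩
  -- Every qubit is excited with probability 1/N, where N = n + 1. The squared overlap is then (n/(n
  -- + 1))^n, including the case N = 1, where 0^0 = 1.
  refine ⟨fun _ => !₂[((√(n / (n + 1)) : ℝ) : ℂ), ((√(1 / (n + 1)) : ℝ) : ℂ)], fun _ => ?_, ?_⟩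
  · rw [EuclideanSpace.norm_eq, Real.sqrt_eq_one]
    simp only [Fin.sum_univ_two]
    simp only [Matrix.cons_val_zero, Matrix.cons_val_one, Complex.norm_real, Real.norm_eq_abs,
      sq_abs]
    rw [Real.sq_sqrt (by positivity), Real.sq_sqrt (by positivity)]
    field_simp
  · rw [inner_wVec_productVec]
    simp only [Matrix.cons_val_zero, Matrix.cons_val_one, Finset.prod_const, Finset.sum_const,
      Finset.card_erase_of_mem (Finset.mem_univ _), Finset.card_univ, Fintype.card_fin,
      nsmul_eq_mul, Nat.add_sub_cancel]
    rw [← Complex.ofReal_pow, ← Complex.ofReal_mul, ← Complex.ofReal_natCast,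
      ← Complex.ofReal_mul, ← Complex.ofReal_mul, Complex.norm_real, Real.norm_eq_abs, sq_abs,
      mul_pow, mul_pow, mul_pow, div_pow, Real.sq_sqrt (by positivity),
      Real.sq_sqrt (by positivity), ← pow_mul, mul_comm n 2, pow_mul,
      Real.sq_sqrt (by positivity)]
    refine (inv_exp_one_le_pow n).trans (le_of_eq ?_)
    push_cast
    field_simp

theorem familyEntanglement_wFamily :
    familyEntanglement geometricMeasure wFamily = ((1 - 1 / Real.exp 1 : ℝ) : EReal) := by
  apply le_antisymm
  · refine iSup₂_le ?_
    rintro s ⟨N, hN, rfl⟩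
    obtain ⟨φ, hφ, hle⟩ := exists_inv_exp_one_le_norm_inner_wVec hN
    refine EReal.coe_le_coe ((geometricMeasure_toState_le _).trans ?_)
    exact sub_le_sub_left (hle.trans (le_maxProductFidelity (wState N hN) hφ)) 1
  -- No single W state is claimed to attain the value: lower bounds for N = n + 3 are passed to the
  -- limit. The shift meets the requirement of at least three qubits.
  · have hbound : ∀ n : ℕ, ((1 - (1 + 1 / ((n + 2 : ℕ) : ℝ)) * (1 / Real.exp 1) : ℝ) : EReal)
        ≤ familyEntanglement geometricMeasure wFamily := by
      intro n
      refine le_trans ?_ (le_iSup₂ (f := fun (s : Σ N : ℕ, State N) (_ : s ∈ wFamily) =>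
        ((geometricMeasure s.1 s.2 : ℝ) : EReal)) ⟨_, (wState (n + 2 + 1) (by lia)).toState⟩
        ⟨_, _, rfl⟩)
      exact EReal.coe_le_coe (geometricMeasure_toState_ge (by positivity) fun φ hφ =>
        norm_inner_wVec_productVec_sq_le (by lia) hφ)
    refine le_of_tendsto' (x := Filter.atTop) ?_ hbound
    refine (continuous_coe_real_ereal.tendsto _).comp ?_
    have h := (tendsto_one_div_atTop_nhds_zero_nat (𝕜 := ℝ)).comp (Filter.tendsto_add_atTop_nat 2)
    simpa using ((h.const_add 1).mul_const (1 / Real.exp 1)).const_sub 1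

/-! ### Distances related to the fidelity -/

theorem StrictlyRelated.expectation_ge {D : StateDistance} {η : ℝ → ℝ} (h : StrictlyRelated D η)
    {ε : ℝ} (hε : ε ∈ D.domain) {N : ℕ} {T : PureState N} {ρ : State N}
    (hρ : D.val ρ T.toState ≤ ε) : 1 - η ε ≤ expectation T ρ.mat := by
  rw [← fidelity_toState_left]
  refine h.fidelity_ge ε hε N _ _ ?_
  rwa [StateDistance.val, (D N).dist_comm]

/-- The witnesses are m Bell pairs, for which δ = 2^(-m); the error 2√δ + δ vanishes as m grows. -/
theorem StrictlyRelated.one_sub_le_asymptoticEntanglement {D : StateDistance} {η : ℝ → ℝ}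
    (h : StrictlyRelated D η) {ε : ℝ} (hε : ε ∈ D.domain) :
    ((1 - η ε : ℝ) : EReal) ≤ asymptoticEntanglement (epsMeasure D geometricMeasure ε) := by
  have hbound : ∀ m : ℕ, ((1 - η ε - (2 * √((1 / 2) ^ m) + (1 / 2) ^ m) : ℝ) : EReal)
      ≤ asymptoticEntanglement (epsMeasure D geometricMeasure ε) := by
    intro m
    refine le_trans (EReal.coe_le_coe ?_) (le_iSup (fun s : Σ N : ℕ, State N =>
      ((epsMeasure D geometricMeasure ε s.1 s.2 : ℝ) : EReal)) ⟨m + m, (bellState m).toState⟩)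
    apply le_csInf
    -- The ε-ball contains its centre because ε ≥ 0, so the infimum is over a nonempty set.
    · refine ⟨_, (bellState m).toState, ?_, rfl⟩
      rw [StateDistance.val, (D _).dist_self]
      exact hε.1
    · rintro r ⟨σ, hσ, rfl⟩
      refine le_trans ?_ (geometricMeasure_ge_fidelity (by positivity)
        (productBound_bellVec m).of_unit (T := bellState m) σ)
      rw [fidelity_toState_left]
      exact sub_le_sub_right (h.expectation_ge hε hσ) _
  refine le_of_tendsto' (x := Filter.atTop) ?_ hbound
  refine (continuous_coe_real_ereal.tendsto _).comp ?_
  have hp := tendsto_pow_atTop_nhds_zero_of_lt_one (r := (1 / 2 : ℝ)) (by norm_num) (by norm_num)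
  simpa using (((hp.sqrt.const_mul 2).add hp).const_sub (1 - η ε))

/-- For `x = t³` with `0 ≤ t ≤ 1/10`. -/
theorem one_sub_inv_exp_lt_and_le {x : ℝ} (h0 : 0 ≤ x) (h1 : x ≤ 1 / 1000) :
    1 - 1 / Real.exp 1 < 1 - 4 * x ^ (1 / 3 : ℝ) + 3.4 * x ^ (2 / 3 : ℝ) ∧
      1 - 4 * x ^ (1 / 3 : ℝ) + 3.4 * x ^ (2 / 3 : ℝ) ≤ 1 - x := by
  have ht0 : 0 ≤ x ^ (1 / 3 : ℝ) := Real.rpow_nonneg h0 _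
  have ht3 : (x ^ (1 / 3 : ℝ)) ^ 3 = x := by
    rw [← Real.rpow_natCast, ← Real.rpow_mul h0]
    norm_num
  have ht2 : x ^ (2 / 3 : ℝ) = (x ^ (1 / 3 : ℝ)) ^ 2 := by
    rw [← Real.rpow_natCast, ← Real.rpow_mul h0]
    norm_num
  rw [ht2]
  set t := x ^ (1 / 3 : ℝ)
  have ht1 : t ≤ 1 / 10 := by
    refine le_of_pow_le_pow_left₀ three_ne_zero (by norm_num) ?_
    rw [ht3]
    exact h1.trans (by norm_num)
  have he : 0.367 < 1 / Real.exp 1 := by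
    rw [lt_div_iff₀ (Real.exp_pos 1)]
    linarith [Real.exp_one_lt_d9]
  constructor
  -- The polynomial decreases on [0, 1/10] and equals 0.634 at 1/10, while 1 - 1/e < 0.633.
  · nlinarith
  -- The claim is t(4 - 3.4t - t²) ≥ 0.
  · rw [← ht3]
    nlinarith [mul_nonneg ht0 ht0]

/-- The W states are not an approximate universal resource: they have a fidelity of at least
`1/e` with factorized states, and thus cannot be transformed into many Bell pairs. -/
theorem StrictlyRelated.not_isApproxUniversal_wFamily {D : StateDistance} {η : ℝ → ℝ}
    (h : StrictlyRelated D η) {εbar : ℝ} (hεbar : εbar ∈ D.domain) (hη : η εbar ≤ 1 / 1000)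
    {ε : ℝ} (hε : ε ≤ εbar) : ¬ IsApproxUniversal D ε wFamily := by
  intro huniv
  -- Ten pairs suffice: (3/2)(1 - 0.367) + 3/1024 < 0.96, below the required 0.999.
  obtain ⟨k, σ, ⟨N, hN, hσ⟩, Λ, hΛ⟩ := huniv (10 + 10) (by norm_num) (bellState 10)
  obtain ⟨hNk, hσ⟩ := Sigma.mk.inj_iff.mp hσ
  subst hNk
  obtain rfl := eq_of_heq hσ
  obtain ⟨φ, hφ, hq⟩ := exists_inv_exp_one_le_norm_inner_wVec hN
  have h1 := Λ.sum_expectation_output_le (ψ := wState _ hN) (T := (bellState 10).pad k)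
    (by positivity) ((productBound_bellVec 10).padVec (by positivity) k) hφ hq
  have h2 := Λ.mul_successProb_le (ε := ε) (wState _ hN) ((bellState 10).pad k)
    fun ρ hρ => h.expectation_ge hεbar (hρ.trans hε)
  have h3 : 1 - η εbar ≤ (1 - η εbar) *
      Λ.successProb D ε (wState _ hN).toState ((bellState 10).pad k).toState :=
    le_mul_of_one_le_right (by linarith) (by linarith)
  have he : 0.367 < 1 / Real.exp 1 := by
    rw [lt_div_iff₀ (Real.exp_pos 1)]
    linarith [Real.exp_one_lt_d9]
  norm_num at h1
  rw [one_div] at he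
  linarith

/-- The two basis states of one qubit are distinct, so a metric separates them by a positive
distance. -/
theorem StateDistance.exists_Ico_subset_domain (D : StateDistance) :
    ∃ c > 0, Set.Ico 0 c ⊆ D.domain := by
  let e (b : Fin 2) : State 1 :=
    PureState.toState ⟨EuclideanSpace.single (fun _ => b) 1, by simp⟩
  have hne : e 0 ≠ e 1 := by
    intro h
    have h1 := congrFun (congrFun (congrArg State.mat h) fun _ => 0) fun _ => 0
    have h01 : (fun _ : Fin 1 => (0 : Fin 2)) ≠ fun _ => 1 := fun h => by
      simpa using congrFun h 0
    simp [e, PureState.toState, PureState.proj, Matrix.vecMulVec_apply, h01] at h1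
  refine ⟨D.val (e 0) (e 1), ?_, fun ε hε => ⟨hε.1, 1, e 0, e 1, hε.2⟩⟩
  let _ := D 1
  exact dist_pos.mpr hne

theorem StrictlyRelated.exists_pos_le {D : StateDistance} {η : ℝ → ℝ} (h : StrictlyRelated D η)
    (hη : ContinuousWithinAt η (Set.Ici 0) 0) {δ : ℝ} (hδ : 0 < δ) :
    ∃ ε ∈ D.domain, 0 < ε ∧ η ε ≤ δ := by
  obtain ⟨c, hc, hcD⟩ := D.exists_Ico_subset_domain
  have hη' : Filter.Tendsto η (nhdsWithin 0 (Set.Ioi 0)) (nhds 0) := by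
    have := hη.mono Set.Ioi_subset_Ici_self
    rwa [ContinuousWithinAt, h.zero] at this
  -- Approaching 0 through positive values only is what yields ε > 0.
  obtain ⟨ε, hε, hεc⟩ :=
    ((hη'.eventually_lt_const hδ).and (Ioo_mem_nhdsGT hc)).exists
  exact ⟨ε, hcD ⟨hεc.1.le, hεc.2⟩, hεc.1, hε.le⟩

end MQC

theorem mainTheorem9 :
    MQC.familyEntanglement MQC.geometricMeasure MQC.wFamily
        = ((1 - 1 / Real.exp 1 : ℝ) : EReal) ∧
    ∀ (D : MQC.StateDistance) (η : ℝ → ℝ), MQC.StrictlyRelated D η →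
      (∀ ε ∈ D.domain, η ε ≤ 1 / 1000 →
        MQC.familyEntanglement MQC.geometricMeasure MQC.wFamily
            < ((1 - 4 * η ε ^ (1 / 3 : ℝ) + 3.4 * η ε ^ (2 / 3 : ℝ) : ℝ) : EReal) ∧
        ((1 - 4 * η ε ^ (1 / 3 : ℝ) + 3.4 * η ε ^ (2 / 3 : ℝ) : ℝ) : EReal)
            ≤ MQC.asymptoticEntanglement (MQC.epsMeasure D MQC.geometricMeasure ε)) ∧
      (∀ εbar ∈ D.domain, η εbar ≤ 1 / 1000 →
        ∀ ε ≤ εbar, ¬ MQC.IsApproxUniversal D ε MQC.wFamily) ∧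
      (ContinuousWithinAt η (Set.Ici 0) 0 →
        ∃ εbar ∈ D.domain, 0 < εbar ∧ η εbar ≤ 1 / 1000) := by
  refine ⟨MQC.familyEntanglement_wFamily, fun D η h => ⟨fun ε hε hη => ?_, fun εbar hεbar hη ε hε =>
    h.not_isApproxUniversal_wFamily hεbar hη hε, fun hη => h.exists_pos_le hη (by norm_num)⟩⟩
  obtain ⟨hlt, hle⟩ := MQC.one_sub_inv_exp_lt_and_le (h.mem_Icc ε hε).1 hη
  constructor
  · rw [MQC.familyEntanglement_wFamily]
    exact EReal.coe_lt_coe_iff.mpr hlt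
  · exact (EReal.coe_le_coe hle).trans (h.one_sub_le_asymptoticEntanglement hε)
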